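/- Let $\gamma$ denote Euler's constant, let $\zeta^{(\ell)}$ denote the $\ell$-th derivative of the Riemann zeta function, and write $\log_2 T = \log\log T$ and $\log_3 T = \log\log\log T$. There are absolute constants $C$ and $T_0$ such that for every real $T \ge T_0$ and every positive integer $\ell \le (\log T)/(\log_2 T)$, \[ \max_{T\le t\le 2T}\bigl|\zeta^{(\ell)}(1+it)\bigr| \;\ge\; e^{\gamma}\cdot \ell^{\ell}\cdot(\ell+1)^{-(\ell+1)}\cdot\bigl(\log_2 T-\log_3 T-C\bigr)^{\ell+1}. \] In other words, if $T$ is sufficiently large, then uniformly for all positive integers $\ell \le (\log T)/(\log_2 T)$, the maximum is at least $e^{\gamma}\,\ell^{\ell}(\ell+1)^{-(\ell+1)}\bigl(\log_2 T-\log_3 T+O(1)\bigr)^{\ell+1}$, where the implied constant in $O(1)$ is absolute. -/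

import Mathlib

open Filter Topology MeasureTheory

/-! The constant is weaker than it looks. By Bernoulli `(1 + 1/ℓ)^ℓ ≥ 2`, and `e^γ < 1.95`, so the
target is at most `0.975 L^(ℓ+1) / (ℓ+1)` with `L = log₂ T - log₃ T - C`. Hence no Euler product has
to produce `e^γ`: it suffices to recover nearly all of `∑ (log n)^ℓ / n` over `n ≤ Y`, where `log Y
≥ L`, since this sum is about `(log Y)^(ℓ+1) / (ℓ+1)`.

On `[T, 2T]`, comparison of sum and integral replaces `ζ^(ℓ)(1+it)`, up to sign, by the Dirichlet
polynomial of length `T²` with coefficients `(log n)^ℓ / n`, with error `O(3^ℓ)`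
(`norm_iteratedDeriv_zeta_sub_sum_le_three_pow`).

The polynomial is then averaged against `|R(t)|²`, where `R(t) = ∑ a^(-it)` over the divisors `a` of
`D = primorial Y ^ E`, and against a Gaussian concentrated in `[T, 2T]`. As `D² ≤ T`, only the
relations `n a = a'` survive, and all of them count positively (`resonance_bound`). For `n ≤ Y`
almost every divisor `a` keeps `n a` a divisor of `D`, because `E` is large compared with the number
of prime factors of `n` (`card_filter_mul_mem_divisors`). So the average is at least about `0.998 ∑
(log n)^ℓ / n`, and the margin between `0.975` and `1` absorbs every loss. -/

/-! ### Sums of `(log n)^l n^(-s)` against their integral -/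

/-- The explicit antiderivative of `(log x) ^ l * x ^ (-s)`. -/
noncomputable def logPowAntideriv (s : ℂ) : ℕ → ℝ → ℂ
  | 0, x => (x : ℂ) ^ (1 - s) / (1 - s)
  | l + 1, x => (x : ℂ) ^ (1 - s) / (1 - s) * (Real.log x : ℂ) ^ (l + 1)
      - (l + 1) / (1 - s) * logPowAntideriv s l x

theorem hasDerivAt_ofReal_cpow_div {s : ℂ} (hs : s ≠ 1) {x : ℝ} (hx : 0 < x) :
    HasDerivAt (fun y : ℝ => (y : ℂ) ^ (1 - s) / (1 - s)) ((x : ℂ) ^ (-s)) x := by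
  have h := hasDerivAt_ofReal_cpow_const' hx.ne' (r := -s)
    (by intro h; exact hs (neg_injective h))
  have e : -s + 1 = 1 - s := by ring
  rwa [e] at h

theorem hasDerivAt_ofReal_log_pow (l : ℕ) {x : ℝ} (hx : 0 < x) :
    HasDerivAt (fun y : ℝ => (Real.log y : ℂ) ^ l)
      (l * (Real.log x : ℂ) ^ (l - 1) * (x : ℂ)⁻¹) x := by
  have h := ((Real.hasDerivAt_log hx.ne').ofReal_comp).fun_pow l
  refine h.congr_deriv ?_
  push_cast
  rfl

theorem hasDerivAt_logPowAntideriv {s : ℂ} (hs : s ≠ 1) (l : ℕ) {x : ℝ} (hx : 0 < x) :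
    HasDerivAt (logPowAntideriv s l) ((Real.log x : ℂ) ^ l * (x : ℂ) ^ (-s)) x := by
  have hs' : 1 - s ≠ 0 := sub_ne_zero.mpr hs.symm
  have hxc : (x : ℂ) ≠ 0 := by exact_mod_cast hx.ne'
  induction l with
  | zero => simpa [logPowAntideriv] using hasDerivAt_ofReal_cpow_div hs hx
  | succ l ih =>
    have h := ((hasDerivAt_ofReal_cpow_div hs hx).mul (hasDerivAt_ofReal_log_pow (l + 1) hx)).sub
      (ih.const_mul (((l : ℂ) + 1) / (1 - s)))
    refine h.congr_deriv ?_
    have e : (x : ℂ) ^ (1 - s) = x * (x : ℂ) ^ (-s) := by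
      rw [sub_eq_add_neg, Complex.cpow_add _ _ hxc, Complex.cpow_one]
    rw [e]
    push_cast
    field_simp
    ring

/-- Each integration by parts costs a factor `l / (T log x)`, at most `1/2` under `hl`. The
lower-order terms therefore at most double the leading one. -/
theorem norm_logPowAntideriv_le {s : ℂ} {T : ℝ} (hT : 0 < T) (hs : T ≤ ‖1 - s‖) (l : ℕ) {x : ℝ}
    (hx : 1 < x) (hl : 2 * (l : ℝ) ≤ T * Real.log x) :
    ‖logPowAntideriv s l x‖ ≤ 2 * (x ^ (1 - s.re) * Real.log x ^ l / T) := by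
  have hx0 : 0 < x := by linarith
  have hL : 0 < Real.log x := Real.log_pos hx
  have hn : ‖(x : ℂ) ^ (1 - s)‖ = x ^ (1 - s.re) := by
    rw [Complex.norm_cpow_eq_rpow_re_of_pos hx0]; simp
  have hxp : 0 < x ^ (1 - s.re) := Real.rpow_pos_of_pos hx0 _
  induction l with
  | zero =>
    simp only [logPowAntideriv, norm_div, hn, pow_zero, mul_one]
    have : x ^ (1 - s.re) / ‖1 - s‖ ≤ x ^ (1 - s.re) / T := by gcongr
    have : 0 ≤ x ^ (1 - s.re) / T := by positivity
    linarith
  | succ l ih =>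
    push_cast at hl
    have ih := ih (by linarith)
    have h1 : ‖(x : ℂ) ^ (1 - s) / (1 - s) * (Real.log x : ℂ) ^ (l + 1)‖
        ≤ x ^ (1 - s.re) * Real.log x ^ (l + 1) / T := by
      rw [norm_mul, norm_div, hn, norm_pow, Complex.norm_real, Real.norm_of_nonneg hL.le,
        div_mul_eq_mul_div]
      gcongr
    have h2 : ‖((l : ℂ) + 1) / (1 - s) * logPowAntideriv s l x‖
        ≤ x ^ (1 - s.re) * Real.log x ^ (l + 1) / T := by
      rw [norm_mul, norm_div]
      have : ‖(l : ℂ) + 1‖ = l + 1 := by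
        have := Complex.norm_natCast (l + 1)
        push_cast at this; exact this
      rw [this]
      calc ((l : ℝ) + 1) / ‖1 - s‖ * ‖logPowAntideriv s l x‖
          ≤ (l + 1) / T * (2 * (x ^ (1 - s.re) * Real.log x ^ l / T)) := by gcongr
        _ = 2 * (l + 1) * (x ^ (1 - s.re) * Real.log x ^ l / T / T) := by ring
        _ ≤ T * Real.log x * (x ^ (1 - s.re) * Real.log x ^ l / T / T) := by gcongr
        _ = x ^ (1 - s.re) * Real.log x ^ (l + 1) / T := by field_simp; ring
    calc _ ≤ _ := norm_sub_le _ _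
      _ ≤ _ := by linarith

theorem hasDerivAt_log_pow_mul_cpow (s : ℂ) (l : ℕ) {x : ℝ} (hx : 0 < x) :
    HasDerivAt (fun y : ℝ => (Real.log y : ℂ) ^ l * (y : ℂ) ^ (-s))
      (l * (Real.log x : ℂ) ^ (l - 1) * (x : ℂ)⁻¹ * (x : ℂ) ^ (-s)
        + (Real.log x : ℂ) ^ l * (-s * (x : ℂ) ^ (-s - 1))) x := by
  have hxc : (x : ℂ) ∈ Complex.slitPlane := by simp [hx]
  have h := (hasDerivAt_id (x : ℂ)).cpow_const (c := -s) hxc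
  have h2 := h.comp_ofReal
  refine ((hasDerivAt_ofReal_log_pow l hx).mul h2).congr_deriv ?_
  simp

theorem norm_deriv_log_pow_mul_cpow_le {s : ℂ} (hs : 1 ≤ s.re) (l : ℕ) {x : ℝ}
    (hx : 1 ≤ x) (hL : 1 ≤ Real.log x) :
    ‖l * (Real.log x : ℂ) ^ (l - 1) * (x : ℂ)⁻¹ * (x : ℂ) ^ (-s)
        + (Real.log x : ℂ) ^ l * (-s * (x : ℂ) ^ (-s - 1))‖
      ≤ (l + ‖s‖) * (Real.log x ^ l / x ^ 2) := by
  have hx0 : 0 < x := by linarith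
  have hxc : (x : ℂ) ≠ 0 := by exact_mod_cast hx0.ne'
  have hn : ‖(x : ℂ) ^ (-s - 1)‖ ≤ 1 / x ^ 2 := by
    rw [Complex.norm_cpow_eq_rpow_re_of_pos hx0, one_div, ← Real.rpow_natCast x 2,
      ← Real.rpow_neg hx0.le]
    apply Real.rpow_le_rpow_of_exponent_le hx
    simp; linarith
  have e : (x : ℂ)⁻¹ * (x : ℂ) ^ (-s) = (x : ℂ) ^ (-s - 1) := by
    rw [Complex.cpow_sub _ _ hxc, Complex.cpow_one]; field_simp
  rw [mul_assoc _ (x : ℂ)⁻¹, e]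
  have hlog : ‖(Real.log x : ℂ)‖ = Real.log x := by
    rw [Complex.norm_real, Real.norm_of_nonneg (by linarith)]
  refine (norm_add_le _ _).trans ?_
  simp only [norm_mul, norm_pow, hlog, norm_neg, Complex.norm_natCast]
  have h1 : Real.log x ^ (l - 1) ≤ Real.log x ^ l := pow_le_pow_right₀ hL (Nat.sub_le _ _)
  calc _ ≤ (l : ℝ) * Real.log x ^ l * (1 / x ^ 2) + Real.log x ^ l * (‖s‖ * (1 / x ^ 2)) := by
        gcongr
    _ = _ := by ring

theorem hasDerivAt_neg_log_pow_div (c : ℝ) (l : ℕ) {x : ℝ} (hx : 0 < x) :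
    HasDerivAt (fun y : ℝ => -(2 * c * Real.log y ^ l / y))
      (2 * c * (Real.log x ^ l - l * Real.log x ^ (l - 1)) / x ^ 2) x := by
  have h := ((((Real.hasDerivAt_log hx.ne').pow l).const_mul (2 * c)).div (hasDerivAt_id x)
    hx.ne').neg
  refine h.congr_deriv ?_
  simp
  field_simp
  ring

/-- Supplies a majorant with an explicit antiderivative: for `2l ≤ log x` the term from
differentiating `(log x)^l` takes away at most half of the main term, which the factor 2 repairs. -/
theorem log_pow_div_le_deriv {c : ℝ} (hc : 0 ≤ c) (l : ℕ) {x : ℝ} (hx : 1 < x)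
    (hl : 2 * (l : ℝ) ≤ Real.log x) :
    c * (Real.log x ^ l / x ^ 2)
      ≤ 2 * c * (Real.log x ^ l - l * Real.log x ^ (l - 1)) / x ^ 2 := by
  have hL : 0 < Real.log x := Real.log_pos hx
  have key : Real.log x ^ l ≤ 2 * (Real.log x ^ l - l * Real.log x ^ (l - 1)) := by
    rcases l with _ | l
    · simp
    · have : (2 * ((l + 1 : ℕ) : ℝ)) * Real.log x ^ l ≤ Real.log x * Real.log x ^ l := by gcongr
      simp only [Nat.add_sub_cancel]
      rw [pow_succ']
      linarith
  calc c * (Real.log x ^ l / x ^ 2) = c * Real.log x ^ l / x ^ 2 := by ring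
    _ ≤ c * (2 * (Real.log x ^ l - l * Real.log x ^ (l - 1))) / x ^ 2 := by gcongr
    _ = _ := by ring

/-- First-order Euler–Maclaurin on one unit interval. The bound is a difference of values of one
function at `x` and `x + 1`, so that it telescopes on summation. -/
theorem norm_antideriv_sub_sub_le {s : ℂ} (hs : s ≠ 1) (hs1 : 1 ≤ s.re) (l : ℕ) {x : ℝ}
    (hx : 1 < x) (hL : 1 ≤ Real.log x) (hl : 2 * (l : ℝ) ≤ Real.log x) :
    ‖logPowAntideriv s l (x + 1) - logPowAntideriv s l x
        - (Real.log (x + 1) : ℂ) ^ l * ((x + 1 : ℝ) : ℂ) ^ (-s)‖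
      ≤ 2 * (l + ‖s‖) * Real.log x ^ l / x - 2 * (l + ‖s‖) * Real.log (x + 1) ^ l / (x + 1) := by
  set c : ℝ := l + ‖s‖ with hc
  have hc0 : 0 ≤ c := by positivity
  set F : ℝ → ℂ := fun y => (Real.log y : ℂ) ^ l * (y : ℂ) ^ (-s) with hF
  -- `φ y` is the integral of `F` over `[x, y]` minus `(y - x) F y`. It vanishes at `x` and has
  -- derivative `-(y - x) F' y`, so a bound on `F'` alone controls it.
  set φ : ℝ → ℂ := fun y => logPowAntideriv s l y - logPowAntideriv s l x
    - ((y : ℂ) - x) * F y with hφ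
  set F' : ℝ → ℂ := fun y => l * (Real.log y : ℂ) ^ (l - 1) * (y : ℂ)⁻¹ * (y : ℂ) ^ (-s)
        + (Real.log y : ℂ) ^ l * (-s * (y : ℂ) ^ (-s - 1)) with hF'
  have hd : ∀ y : ℝ, 0 < y → HasDerivAt φ (-(((y : ℂ) - x) * F' y)) y := by
    intro y hy
    have h1 : HasDerivAt (fun z : ℝ => (z : ℂ) - x) 1 y :=
      (hasDerivAt_id y).ofReal_comp.sub_const _
    have h := ((hasDerivAt_logPowAntideriv hs l hy).sub_const (logPowAntideriv s l x)).sub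
      (h1.mul (hasDerivAt_log_pow_mul_cpow s l hy))
    refine h.congr_deriv ?_
    simp only [hF', one_mul]; ring
  have hB : ∀ y : ℝ, 0 < y → HasDerivAt
      (fun y : ℝ => -(2 * c * Real.log y ^ l / y) + 2 * c * Real.log x ^ l / x)
      (2 * c * (Real.log y ^ l - l * Real.log y ^ (l - 1)) / y ^ 2) y := fun y hy =>
    (hasDerivAt_neg_log_pow_div c l hy).add_const _
  have hpos : ∀ y ∈ Set.Icc x (x + 1), 0 < y := fun y hy => by linarith [hy.1]
  have := image_norm_le_of_norm_deriv_right_le_deriv_boundary' (f := φ) (a := x) (b := x + 1)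
    (f' := fun y => -(((y : ℂ) - x) * F' y))
    (fun y hy => (hd y (hpos y hy)).continuousAt.continuousWithinAt)
    (fun y hy => (hd y (hpos y ⟨hy.1, hy.2.le⟩)).hasDerivWithinAt)
    (B := fun y : ℝ => -(2 * c * Real.log y ^ l / y) + 2 * c * Real.log x ^ l / x)
    (B' := fun y => 2 * c * (Real.log y ^ l - l * Real.log y ^ (l - 1)) / y ^ 2)
    (by simp [hφ])
    (fun y hy => (hB y (hpos y hy)).continuousAt.continuousWithinAt)
    (fun y hy => (hB y (hpos y ⟨hy.1, hy.2.le⟩)).hasDerivWithinAt)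
    (fun y hy => ?_) (x := x + 1) ⟨by linarith, le_rfl⟩
  · simp only [hφ, hF] at this
    have e : ((x + 1 : ℝ) : ℂ) - x = 1 := by push_cast; ring
    rw [e, one_mul] at this
    linarith
  · have hxy : Real.log x ≤ Real.log y := Real.log_le_log (by linarith) hy.1
    have h1 : ‖F' y‖ ≤ c * (Real.log y ^ l / y ^ 2) :=
      norm_deriv_log_pow_mul_cpow_le hs1 l (by linarith [hy.1]) (by linarith)
    have h2 := log_pow_div_le_deriv hc0 l (x := y) (by linarith [hy.1]) (by linarith)
    have h3 : ‖(y : ℂ) - x‖ ≤ 1 := by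
      rw [← Complex.ofReal_sub, Complex.norm_real, Real.norm_of_nonneg (by linarith [hy.1])]
      linarith [hy.2]
    rw [norm_neg, norm_mul]
    calc ‖(y : ℂ) - x‖ * ‖F' y‖ ≤ 1 * ‖F' y‖ := by gcongr
      _ ≤ _ := by linarith

theorem norm_sum_log_pow_mul_cpow_le {s : ℂ} (hs : s ≠ 1) (hs1 : 1 ≤ s.re) (l : ℕ) {X : ℕ}
    (hX : 1 < X) (hL : 1 ≤ Real.log X) (hl : 2 * (l : ℝ) ≤ Real.log X) {Z : ℕ} (hZ : X ≤ Z) :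
    ‖logPowAntideriv s l Z - logPowAntideriv s l X
        - ∑ n ∈ Finset.Ioc X Z, (Real.log n : ℂ) ^ l * (n : ℂ) ^ (-s)‖
      ≤ 2 * (l + ‖s‖) * Real.log X ^ l / X - 2 * (l + ‖s‖) * Real.log Z ^ l / Z := by
  induction Z, hZ using Nat.le_induction with
  | base => simp
  | succ Z hZ ih =>
    have hXZ : (X : ℝ) ≤ Z := by exact_mod_cast hZ
    have hX1 : (1 : ℝ) < X := by exact_mod_cast hX
    have hlog : Real.log X ≤ Real.log Z := Real.log_le_log (by linarith) hXZ
    have h := norm_antideriv_sub_sub_le hs hs1 l (x := Z) (by linarith) (by linarith)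
      (by linarith)
    rw [← Finset.insert_Ioc_right_eq_Ioc_add_one (by omega), Finset.sum_insert (by simp)]
    simp only [Nat.cast_add, Nat.cast_one, Complex.ofReal_add, Complex.ofReal_one,
      Complex.ofReal_natCast] at h ⊢
    calc _ = ‖(logPowAntideriv s l Z - logPowAntideriv s l X
        - ∑ n ∈ Finset.Ioc X Z, (Real.log n : ℂ) ^ l * (n : ℂ) ^ (-s)) +
        (logPowAntideriv s l (Z + 1) - logPowAntideriv s l Z
        - (Real.log (Z + 1) : ℂ) ^ l * ((Z : ℂ) + 1) ^ (-s))‖ := by congr 1; ring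
      _ ≤ _ := (norm_add_le _ _).trans (by linarith)

/-! ### Approximating the derivatives of zeta by a Dirichlet polynomial -/

theorem logMul_iterate_one_apply (l n : ℕ) :
    LSeries.logMul^[l] 1 n = (Real.log n : ℂ) ^ l := by
  induction l with
  | zero => simp
  | succ l ih =>
    rw [Function.iterate_succ_apply', LSeries.logMul, ih, Complex.natCast_log, pow_succ']

theorem tendsto_sum_log_pow_mul_cpow {s : ℂ} (hs : 1 < s.re) (l : ℕ) :
    Tendsto (fun Z : ℕ => (-1) ^ l * ∑ n ∈ Finset.Ioc 0 Z, (Real.log n : ℂ) ^ l * (n : ℂ) ^ (-s))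
      atTop (𝓝 (iteratedDeriv l riemannZeta s)) := by
  have habs : LSeries.abscissaOfAbsConv (1 : ℕ → ℂ) < s.re := by
    rw [LSeries.abscissaOfAbsConv_one]; exact_mod_cast hs
  have hev : LSeries 1 =ᶠ[𝓝 s] riemannZeta := by
    filter_upwards [(isOpen_lt continuous_const Complex.continuous_re).mem_nhds hs] with z hz
    exact LSeries_one_eq_riemannZeta hz
  rw [← hev.iteratedDeriv_eq, LSeries_iteratedDeriv l habs]
  refine Tendsto.const_mul _ ?_
  have hsum : LSeriesSummable (LSeries.logMul^[l] 1) s := by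
    apply LSeriesSummable_of_abscissaOfAbsConv_lt_re
    rwa [LSeries.absicssaOfAbsConv_logPowMul]
  have h := (hsum.hasSum.tendsto_sum_nat).comp (tendsto_add_atTop_nat 1)
  refine h.congr fun Z => ?_
  rw [Function.comp_apply, Finset.sum_range_eq_add_Ico _ (by omega), LSeries.term_zero, zero_add]
  have : Finset.Ico 1 (Z + 1) = Finset.Ioc 0 Z := by ext; simp; omega
  rw [this]
  refine Finset.sum_congr rfl fun n hn => ?_
  have hn0 : n ≠ 0 := by simp at hn; omega
  rw [LSeries.term_of_ne_zero hn0, logMul_iterate_one_apply, Complex.cpow_neg, div_eq_mul_inv]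

theorem norm_iteratedDeriv_zeta_sub_sum_le_of_one_lt_re {s : ℂ} (hs : 1 < s.re) {T : ℝ}
    (hT : 1 ≤ T) (hsT : T ≤ ‖1 - s‖) (l : ℕ) {X : ℕ} (hX : 1 < X) (hL : 1 ≤ Real.log X)
    (hl : 2 * (l : ℝ) ≤ Real.log X) :
    ‖iteratedDeriv l riemannZeta s
        - (-1) ^ l * ∑ n ∈ Finset.Ioc 0 X, (Real.log n : ℂ) ^ l * (n : ℂ) ^ (-s)‖
      ≤ 2 * Real.log X ^ l / T + 2 * (l + ‖s‖) * Real.log X ^ l / X := by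
  have hs1 : s ≠ 1 := by rintro rfl; simp at hs
  have hX1 : (1 : ℝ) < X := by exact_mod_cast hX
  have hT0 : 0 < T := by linarith
  set S : ℕ → ℂ := fun Z => ∑ n ∈ Finset.Ioc 0 Z, (Real.log n : ℂ) ^ l * (n : ℂ) ^ (-s) with hS
  have hlim := ((tendsto_sum_log_pow_mul_cpow hs l).sub_const ((-1) ^ l * S X)).norm
  -- The boundary term at `Z` carries `Z^(1 - Re s)`; its decay is what needs `Re s > 1` strictly.
  have hG : Tendsto (fun Z : ℕ => 2 * ((Z : ℝ) ^ (1 - s.re) * Real.log Z ^ l / T)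
      + (2 * Real.log X ^ l / T + 2 * (l + ‖s‖) * Real.log X ^ l / X)) atTop
      (𝓝 (0 + (2 * Real.log X ^ l / T + 2 * (l + ‖s‖) * Real.log X ^ l / X))) := by
    refine Tendsto.add_const _ ?_
    have h1 := (isLittleO_log_rpow_rpow_atTop (s := s.re - 1) (l : ℝ)
      (by linarith)).tendsto_div_nhds_zero.comp tendsto_natCast_atTop_atTop
    have h2 := h1.const_mul (2 / T)
    rw [mul_zero] at h2
    refine h2.congr' ?_
    filter_upwards [eventually_gt_atTop 0] with Z hZ
    have hZ0 : (0 : ℝ) ≤ Z := by positivity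
    have e : (1 - s.re) = -(s.re - 1) := by ring
    rw [Function.comp_apply, Real.rpow_natCast, e, Real.rpow_neg hZ0]
    ring
  rw [zero_add] at hG
  refine le_of_tendsto_of_tendsto hlim hG ?_
  filter_upwards [eventually_ge_atTop X] with Z hZ
  have hXZ : (X : ℝ) ≤ Z := by exact_mod_cast hZ
  have hlogZ : Real.log X ≤ Real.log Z := Real.log_le_log (by linarith) hXZ
  have hsplit : S Z = S X + ∑ n ∈ Finset.Ioc X Z, (Real.log n : ℂ) ^ l * (n : ℂ) ^ (-s) := by
    rw [hS]
    exact (Finset.sum_Ioc_consecutive _ (Nat.zero_le _) hZ).symm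
  rw [← mul_sub, norm_mul, norm_pow, norm_neg, norm_one, one_pow, one_mul]
  change ‖S Z - S X‖ ≤ _
  rw [hsplit, add_sub_cancel_left]
  have h := norm_sum_log_pow_mul_cpow_le hs1 hs.le l hX hL hl hZ
  have hl' : ∀ y : ℝ, Real.log X ≤ y → 2 * (l : ℝ) ≤ T * y := fun y hy => by nlinarith
  have g1 := norm_logPowAntideriv_le hT0 hsT l hX1 (hl' _ le_rfl)
  have g2 := norm_logPowAntideriv_le hT0 hsT l (hX1.trans_le hXZ) (hl' _ hlogZ)
  have g3 : (X : ℝ) ^ (1 - s.re) * Real.log X ^ l / T ≤ 1 * Real.log X ^ l / T := by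
    gcongr
    exact Real.rpow_le_one_of_one_le_of_nonpos hX1.le (by linarith)
  have g4 : 0 ≤ 2 * (l + ‖s‖) * Real.log Z ^ l / Z := by
    have : 0 ≤ Real.log Z := by linarith
    positivity
  have tri : ∀ a b c : ℂ, ‖c‖ ≤ ‖a‖ + ‖b‖ + ‖a - b - c‖ := fun a b c => by
    calc ‖c‖ = ‖(a - b) - (a - b - c)‖ := by congr 1; ring
      _ ≤ ‖a - b‖ + ‖a - b - c‖ := norm_sub_le _ _
      _ ≤ _ := by gcongr; exact norm_sub_le _ _
  have := tri (logPowAntideriv s l Z) (logPowAntideriv s l X)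
    (∑ n ∈ Finset.Ioc X Z, (Real.log n : ℂ) ^ l * (n : ℂ) ^ (-s))
  have e : 2 * (1 * Real.log X ^ l / T) = 2 * Real.log X ^ l / T := by ring
  linarith

theorem analyticAt_iteratedDeriv_riemannZeta (l : ℕ) {s : ℂ} (hs : s ≠ 1) :
    AnalyticAt ℂ (iteratedDeriv l riemannZeta) s := by
  have h : AnalyticAt ℂ riemannZeta s := by
    have : DifferentiableOn ℂ riemannZeta {1}ᶜ := fun z hz =>
      (differentiableAt_riemannZeta hz).differentiableWithinAt
    exact this.analyticAt (isOpen_compl_singleton.mem_nhds hs)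
  rw [iteratedDeriv_eq_iterate]
  exact h.iterated_deriv l

/-- The bound to the right of the line does not degenerate as `Re s` decreases to 1, and both sides
are continuous there, so it passes to the limit. -/
theorem norm_iteratedDeriv_zeta_sub_sum_le {t : ℝ} (ht : 1 ≤ t) (l : ℕ) {X : ℕ} (hX : 1 < X)
    (hL : 1 ≤ Real.log X) (hl : 2 * (l : ℝ) ≤ Real.log X) :
    ‖iteratedDeriv l riemannZeta (1 + t * Complex.I) - (-1) ^ l *
        ∑ n ∈ Finset.Ioc 0 X, (Real.log n : ℂ) ^ l * (n : ℂ) ^ (-(1 + t * Complex.I))‖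
      ≤ 2 * Real.log X ^ l / t + 2 * (l + ‖1 + t * Complex.I‖) * Real.log X ^ l / X := by
  have hcont : ContinuousAt (fun σ : ℝ => (σ : ℂ) + t * Complex.I) 1 := by fun_prop
  have h1 : ((1 : ℝ) : ℂ) + t * Complex.I ≠ 1 := by
    intro h
    have := congrArg Complex.im h
    simp at this
    linarith
  have hζ : ContinuousAt
      (fun σ : ℝ => iteratedDeriv l riemannZeta (σ + t * Complex.I)) 1 :=
    ContinuousAt.comp (f := fun σ : ℝ => (σ : ℂ) + t * Complex.I)
      (analyticAt_iteratedDeriv_riemannZeta l h1).continuousAt hcont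
  have hS : ContinuousAt (fun σ : ℝ => (-1 : ℂ) ^ l *
      ∑ n ∈ Finset.Ioc 0 X, (Real.log n : ℂ) ^ l * (n : ℂ) ^ (-(σ + t * Complex.I))) 1 := by
    refine continuousAt_const.mul ?_
    refine tendsto_finsetSum _ fun n hn => ?_
    have hn0 : (n : ℂ) ≠ 0 := by
      simp at hn; exact_mod_cast (by omega : n ≠ 0)
    exact continuousAt_const.mul (hcont.neg.const_cpow (Or.inl hn0))
  have hR : ContinuousAt (fun σ : ℝ => 2 * Real.log X ^ l / t
      + 2 * (l + ‖(σ : ℂ) + t * Complex.I‖) * Real.log X ^ l / X) 1 := by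
    have := hcont.norm
    fun_prop
  have A := ((hζ.sub hS).norm.tendsto).mono_left (nhdsWithin_le_nhds (s := Set.Ioi 1))
  have B := (hR.tendsto).mono_left (nhdsWithin_le_nhds (s := Set.Ioi 1))
  have := le_of_tendsto_of_tendsto A B ?_
  · simpa using this
  · filter_upwards [self_mem_nhdsWithin] with σ hσ
    refine norm_iteratedDeriv_zeta_sub_sum_le_of_one_lt_re (by simpa using hσ) ht ?_ l hX hL hl
    refine le_trans ?_ (Complex.abs_im_le_norm _)
    simp [abs_of_nonneg (show 0 ≤ t by linarith)]

/-! ### Gaussian averages of trigonometric sums -/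

theorem integral_cexp_mul_gaussian {b : ℝ} (hb : 0 < b) (u τ : ℝ) :
    ∫ t : ℝ, Complex.exp (-(u * t * Complex.I)) * (Real.exp (-b * (t - τ) ^ 2) : ℂ)
      = (√(Real.pi / b) * Real.exp (-u ^ 2 / (4 * b)) : ℝ)
        * Complex.exp (-(u * τ * Complex.I)) := by
  have h := fourierIntegral_gaussian (b := (b : ℂ)) (by simpa using hb) (-(u : ℂ))
  rw [← integral_sub_right_eq_self _ τ] at h
  have e1 : ((Real.pi : ℂ) / b) ^ (1 / 2 : ℂ) = (√(Real.pi / b) : ℝ) := by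
    rw [Real.sqrt_eq_rpow, Complex.ofReal_cpow (by positivity)]
    push_cast; rfl
  rw [e1] at h
  have e2 : ∀ t : ℝ, Complex.exp (-(u * t * Complex.I)) * (Real.exp (-b * (t - τ) ^ 2) : ℂ)
      = Complex.exp (-(u * τ * Complex.I)) * (Complex.exp (Complex.I * -(u : ℂ) * ((t - τ : ℝ) : ℂ))
        * Complex.exp (-(b : ℂ) * ((t - τ : ℝ) : ℂ) ^ 2)) := by
    intro t
    rw [← mul_assoc, ← Complex.exp_add]
    push_cast
    congr 2
    ring
  simp_rw [e2]
  rw [integral_const_mul, h]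
  push_cast
  rw [neg_sq]
  ring

theorem integrable_gaussian_shift {b : ℝ} (hb : 0 < b) (τ : ℝ) :
    Integrable fun t : ℝ => Real.exp (-b * (t - τ) ^ 2) :=
  (integrable_exp_neg_mul_sq hb).comp_sub_right τ

theorem integral_gaussian_shift (b τ : ℝ) :
    ∫ t : ℝ, Real.exp (-b * (t - τ) ^ 2) = √(Real.pi / b) := by
  rw [integral_sub_right_eq_self (fun t : ℝ => Real.exp (-b * t ^ 2)) τ, integral_gaussian]

theorem integrable_cexp_mul_gaussian {b : ℝ} (hb : 0 < b) (u τ : ℝ) :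
    Integrable fun t : ℝ =>
      Complex.exp (-(u * t * Complex.I)) * (Real.exp (-b * (t - τ) ^ 2) : ℂ) := by
  refine (integrable_gaussian_shift hb τ).ofReal.bdd_mul (c := 1) (by fun_prop) ?_
  refine Filter.Eventually.of_forall fun t => ?_
  rw [Complex.norm_exp]; simp

/-- A finite sum of oscillating terms with frequencies `0` or at least `r` in size is almost
orthogonal to a Gaussian, apart from its constant terms. -/
theorem norm_integral_trig_sum_sub_le {ι : Type*} (s : Finset ι) (c u : ι → ℝ)
    (hc : ∀ i ∈ s, 0 ≤ c i) {b r : ℝ} (hb : 0 < b) (hr : 0 ≤ r) (τ : ℝ)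
    (hu : ∀ i ∈ s, u i = 0 ∨ r ≤ |u i|) :
    ‖(∫ t : ℝ, (∑ i ∈ s, (c i : ℂ) * Complex.exp (-(u i * t * Complex.I)))
        * (Real.exp (-b * (t - τ) ^ 2) : ℂ))
      - (√(Real.pi / b) * ∑ i ∈ s with u i = 0, c i : ℝ)‖
      ≤ √(Real.pi / b) * (Real.exp (-r ^ 2 / (4 * b)) * ∑ i ∈ s, c i) := by
  have e : ∀ t : ℝ, (∑ i ∈ s, (c i : ℂ) * Complex.exp (-(u i * t * Complex.I)))
        * (Real.exp (-b * (t - τ) ^ 2) : ℂ) = ∑ i ∈ s, (c i : ℂ) *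
          (Complex.exp (-(u i * t * Complex.I)) * (Real.exp (-b * (t - τ) ^ 2) : ℂ)) := by
    intro t
    rw [Finset.sum_mul]
    exact Finset.sum_congr rfl fun i _ => by ring
  simp_rw [e]
  rw [integral_finsetSum _ fun i _ => (integrable_cexp_mul_gaussian hb (u i) τ).const_mul _]
  simp_rw [integral_const_mul, integral_cexp_mul_gaussian hb]
  rw [Finset.sum_filter, Finset.mul_sum, Complex.ofReal_sum, ← Finset.sum_sub_distrib,
    Finset.mul_sum, Finset.mul_sum]
  refine norm_sum_le_of_le _ fun i hi => ?_
  have hci := hc i hi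
  by_cases h0 : u i = 0
  · simp only [h0]
    simp
    rw [mul_comm, sub_self, norm_zero]
    positivity
  · have hr' : r ≤ |u i| := (hu i hi).resolve_left h0
    rw [if_neg h0]
    simp only [mul_zero, Complex.ofReal_zero, sub_zero]
    rw [norm_mul, norm_mul, Complex.norm_real, Complex.norm_real, Complex.norm_exp,
      Real.norm_of_nonneg hci, Real.norm_of_nonneg (by positivity)]
    have : (-(↑(u i) * (τ : ℂ) * Complex.I)).re = 0 := by simp
    rw [this, Real.exp_zero, mul_one]
    have h2 : r ^ 2 ≤ u i ^ 2 := by rw [← sq_abs (u i)]; gcongr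
    have h3 : Real.exp (-u i ^ 2 / (4 * b)) ≤ Real.exp (-r ^ 2 / (4 * b)) := by gcongr
    calc c i * (√(Real.pi / b) * Real.exp (-u i ^ 2 / (4 * b)))
        ≤ c i * (√(Real.pi / b) * Real.exp (-r ^ 2 / (4 * b))) := by gcongr
      _ = _ := by ring

/-! ### The resonance method -/

theorem natCast_cpow_neg_mul_I {n : ℕ} (hn : 0 < n) (t : ℝ) :
    (n : ℂ) ^ (-(t * Complex.I)) = Complex.exp (-(Real.log n * t * Complex.I)) := by
  rw [Complex.cpow_def_of_ne_zero (by exact_mod_cast hn.ne'), ← Complex.natCast_log]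
  congr 1; ring

/-- Distinct integers differ by at least 1, so the gap is at least `1 / (m + 1)` with `m` the
smaller one. Bounding only `y` suffices, which matters because `x` will be a product `n * a` that
may exceed `D`. -/
theorem inv_le_abs_log_div {x y D : ℕ} (hx : 0 < x) (hy : 0 < y) (hyD : y ≤ D) (hxy : x ≠ y) :
    1 / (2 * (D : ℝ)) ≤ |Real.log x - Real.log y| := by
  have key : ∀ m k : ℕ, 0 < m → m < k → m + 1 ≤ 2 * D →
      1 / (2 * (D : ℝ)) ≤ Real.log k - Real.log m := by
    intro m k hm hmk hD
    have hm' : (0 : ℝ) < m := by exact_mod_cast hm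
    have hk' : (m : ℝ) + 1 ≤ k := by exact_mod_cast hmk
    have h1 : Real.log (m + 1) ≤ Real.log k := Real.log_le_log (by positivity) hk'
    have h2 := Real.one_sub_inv_le_log_of_pos (x := ((m : ℝ) + 1) / m) (by positivity)
    rw [Real.log_div (by positivity) (by positivity), inv_div] at h2
    have h3 : 1 - (m : ℝ) / (m + 1) = 1 / (m + 1) := by field_simp; ring
    have h4 : 1 / (2 * (D : ℝ)) ≤ 1 / (m + 1) := by
      apply one_div_le_one_div_of_le (by positivity)
      exact_mod_cast hD
    linarith
  rcases lt_or_gt_of_ne hxy with h | h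
  · rw [abs_sub_comm]
    exact (key x y hx h (by omega)).trans (le_abs_self _)
  · exact (key y x hy h (by omega)).trans (le_abs_self _)

theorem norm_natCast_cpow_neg_mul_I {n : ℕ} (hn : 0 < n) (t : ℝ) :
    ‖(n : ℂ) ^ (-(t * Complex.I))‖ = 1 := by
  rw [natCast_cpow_neg_mul_I hn, Complex.norm_exp, Complex.neg_re, ← Complex.ofReal_mul,
    Complex.re_ofReal_mul]
  simp

theorem log_sub_log_eq_zero_iff {x y : ℕ} (hx : 0 < x) (hy : 0 < y) :
    Real.log x - Real.log y = 0 ↔ x = y := by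
  rw [sub_eq_zero]
  constructor
  · intro h
    exact_mod_cast Real.log_injOn_pos (by simpa using hx) (by simpa using hy) h
  · rintro rfl; rfl

/-- The Dirichlet polynomial whose coefficients are the indicator function of `A`. -/
noncomputable def resonator (A : Finset ℕ) (t : ℝ) : ℂ := ∑ a ∈ A, (a : ℂ) ^ (-(t * Complex.I))

theorem resonator_norm_sq {A : Finset ℕ} (hA : ∀ a ∈ A, 0 < a) (t : ℝ) :
    ((‖resonator A t‖ ^ 2 : ℝ) : ℂ) = ∑ p ∈ A ×ˢ A,
      Complex.exp (-((Real.log p.1 - Real.log p.2 : ℝ) * t * Complex.I)) := by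
  rw [← Complex.normSq_eq_norm_sq, ← Complex.mul_conj, resonator, map_sum, Finset.sum_mul_sum,
    Finset.sum_product]
  refine Finset.sum_congr rfl fun a ha => Finset.sum_congr rfl fun a' ha' => ?_
  rw [natCast_cpow_neg_mul_I (hA a ha), natCast_cpow_neg_mul_I (hA a' ha'),
    ← Complex.exp_conj, ← Complex.exp_add]
  congr 1
  simp only [map_neg, map_mul, Complex.conj_ofReal, Complex.conj_I, Complex.ofReal_sub]
  ring

theorem norm_resonator_le {A : Finset ℕ} (hA : ∀ a ∈ A, 0 < a) (t : ℝ) :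
    ‖resonator A t‖ ≤ A.card := by
  refine (norm_sum_le _ _).trans ?_
  rw [Finset.sum_congr rfl fun a ha => norm_natCast_cpow_neg_mul_I (hA a ha) t]
  simp

theorem continuous_resonator {A : Finset ℕ} (hA : ∀ a ∈ A, 0 < a) : Continuous (resonator A) := by
  refine continuous_finsetSum _ fun a ha => ?_
  have : (a : ℂ) ≠ 0 := by exact_mod_cast (hA a ha).ne'
  exact Continuous.const_cpow (by fun_prop) (Or.inl this)

theorem integral_resonator_sq_le {A : Finset ℕ} {D : ℕ} (hA : ∀ a ∈ A, 0 < a ∧ a ≤ D)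
    {b : ℝ} (hb : 0 < b) (τ : ℝ) :
    ∫ t, ‖resonator A t‖ ^ 2 * Real.exp (-b * (t - τ) ^ 2) ≤ √(Real.pi / b) *
      (A.card + (A.card : ℝ) ^ 2 * Real.exp (-(1 / (2 * (D : ℝ))) ^ 2 / (4 * b))) := by
  have h := norm_integral_trig_sum_sub_le (A ×ˢ A) (fun _ => 1)
    (fun p => Real.log p.1 - Real.log p.2) (fun _ _ => zero_le_one) hb
    (r := 1 / (2 * (D : ℝ))) (by positivity) τ (by
      rintro ⟨x, y⟩ hp
      simp only [Finset.mem_product] at hp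
      by_cases hxy : x = y
      · left; simp [hxy]
      · right; exact inv_le_abs_log_div (hA x hp.1).1 (hA y hp.2).1 (hA y hp.2).2 hxy)
  have e : ∀ t : ℝ, (∑ i ∈ A ×ˢ A, ((1 : ℝ) : ℂ) * Complex.exp
      (-((Real.log i.1 - Real.log i.2 : ℝ) * t * Complex.I)))
      * (Real.exp (-b * (t - τ) ^ 2) : ℂ)
      = ((‖resonator A t‖ ^ 2 * Real.exp (-b * (t - τ) ^ 2) : ℝ) : ℂ) := by
    intro t
    simp only [Complex.ofReal_one, one_mul]
    rw [← resonator_norm_sq fun a ha => (hA a ha).1, ← Complex.ofReal_mul]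
  simp_rw [e] at h
  rw [integral_complex_ofReal, ← Complex.ofReal_sub, Complex.norm_real] at h
  have hset : (A ×ˢ A).filter (fun i => Real.log i.1 - Real.log i.2 = 0) = A.diag := by
    ext ⟨x, y⟩
    simp only [Finset.mem_filter, Finset.mem_product, Finset.mem_diag]
    constructor
    · rintro ⟨⟨h1, h2⟩, h3⟩
      exact ⟨h1, (log_sub_log_eq_zero_iff (hA x h1).1 (hA y h2).1).1 h3⟩
    · rintro ⟨h1, rfl⟩
      exact ⟨⟨h1, h1⟩, by simp⟩
  have htot : ∑ i ∈ A ×ˢ A, (1 : ℝ) = (A.card : ℝ) ^ 2 := by simp [sq]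
  have hdiag : ∑ i ∈ A.diag, (1 : ℝ) = A.card := by simp
  rw [hset, hdiag, htot] at h
  have h' := (abs_le.mp h).2
  linarith

/-- Zero frequency means `n a = a'`, and these terms have nonnegative weight. The other frequencies
are at least `1 / (2D)` in size and are damped by the Gaussian. -/
theorem le_norm_integral_mul_resonator_sq {A : Finset ℕ} {D : ℕ}
    (hA : ∀ a ∈ A, 0 < a ∧ a ≤ D) {b : ℝ} (hb : 0 < b) (τ : ℝ) (X : ℕ) (w : ℕ → ℝ)
    (hw : ∀ n, 0 ≤ w n) :
    √(Real.pi / b) *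
      (∑ n ∈ Finset.Ioc 0 X, w n * (((A ×ˢ A).filter fun p => n * p.1 = p.2).card : ℝ)
        - Real.exp (-(1 / (2 * (D : ℝ))) ^ 2 / (4 * b)) *
          ((∑ n ∈ Finset.Ioc 0 X, w n) * (A.card : ℝ) ^ 2))
      ≤ ‖∫ t : ℝ, ((∑ n ∈ Finset.Ioc 0 X, (w n : ℂ) * (n : ℂ) ^ (-(t * Complex.I)))
          * (‖resonator A t‖ ^ 2 : ℝ)) * (Real.exp (-b * (t - τ) ^ 2) : ℂ)‖ := by
  have h := norm_integral_trig_sum_sub_le (Finset.Ioc 0 X ×ˢ (A ×ˢ A)) (fun q => w q.1)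
    (fun q => Real.log (q.1 * q.2.1 : ℕ) - Real.log q.2.2) (fun _ _ => hw _) hb
    (r := 1 / (2 * (D : ℝ))) (by positivity) τ (by
      rintro ⟨n, x, y⟩ hp
      simp only [Finset.mem_product, Finset.mem_Ioc] at hp
      by_cases hxy : n * x = y
      · left; simp only [hxy, sub_self]
      · right
        exact inv_le_abs_log_div (Nat.mul_pos hp.1.1 (hA x hp.2.1).1) (hA y hp.2.2).1
          (hA y hp.2.2).2 hxy)
  have e : ∀ t : ℝ, (∑ q ∈ Finset.Ioc 0 X ×ˢ (A ×ˢ A), (w q.1 : ℂ) * Complex.exp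
      (-((Real.log (q.1 * q.2.1 : ℕ) - Real.log q.2.2 : ℝ) * t * Complex.I)))
      = (∑ n ∈ Finset.Ioc 0 X, (w n : ℂ) * (n : ℂ) ^ (-(t * Complex.I)))
          * (‖resonator A t‖ ^ 2 : ℝ) := by
    intro t
    rw [resonator_norm_sq fun a ha => (hA a ha).1, Finset.sum_mul_sum, Finset.sum_product]
    refine Finset.sum_congr rfl fun n hn => Finset.sum_congr rfl fun p hp => ?_
    simp only [Finset.mem_product, Finset.mem_Ioc] at hn hp
    have hn' : (n : ℝ) ≠ 0 := by exact_mod_cast hn.1.ne'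
    have hp' : (p.1 : ℝ) ≠ 0 := by exact_mod_cast (hA _ hp.1).1.ne'
    rw [natCast_cpow_neg_mul_I hn.1, mul_assoc (w n : ℂ), ← Complex.exp_add]
    congr 2
    rw [Nat.cast_mul, Real.log_mul hn' hp']
    simp only [Complex.ofReal_sub, Complex.ofReal_add]
    ring
  have hdiag : ∑ q ∈ Finset.Ioc 0 X ×ˢ (A ×ˢ A) with
      Real.log (q.1 * q.2.1 : ℕ) - Real.log q.2.2 = 0, w q.1
      = ∑ n ∈ Finset.Ioc 0 X, w n * (((A ×ˢ A).filter fun p => n * p.1 = p.2).card : ℝ) := by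
    rw [Finset.sum_filter, Finset.sum_product]
    refine Finset.sum_congr rfl fun n hn => ?_
    rw [← Finset.sum_filter]
    dsimp only
    rw [Finset.sum_const, nsmul_eq_mul, mul_comm]
    congr 3
    refine Finset.filter_congr fun p hp => ?_
    simp only [Finset.mem_product, Finset.mem_Ioc] at hn hp
    exact log_sub_log_eq_zero_iff (Nat.mul_pos hn.1 (hA _ hp.1).1) (hA _ hp.2).1
  have htot : ∑ q ∈ Finset.Ioc 0 X ×ˢ (A ×ˢ A), w q.1
      = (∑ n ∈ Finset.Ioc 0 X, w n) * (A.card : ℝ) ^ 2 := by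
    rw [Finset.sum_product, Finset.sum_mul]
    refine Finset.sum_congr rfl fun n _ => ?_
    dsimp only
    rw [Finset.sum_const, nsmul_eq_mul, Finset.card_product]
    push_cast; ring
  simp_rw [e] at h
  rw [hdiag, htot] at h
  set Q := ∑ n ∈ Finset.Ioc 0 X, w n * (((A ×ˢ A).filter fun p => n * p.1 = p.2).card : ℝ)
  have hQ0 : 0 ≤ Q := Finset.sum_nonneg fun n _ => mul_nonneg (hw n) (Nat.cast_nonneg _)
  rw [norm_sub_rev] at h
  have h6 := (norm_sub_norm_le _ _).trans h
  rw [Complex.norm_real, Real.norm_of_nonneg (by positivity)] at h6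
  linarith

theorem norm_integral_mul_resonator_sq_le {A : Finset ℕ} (hA : ∀ a ∈ A, 0 < a)
    {T M B : ℝ} (hM0 : 0 ≤ M) (hB0 : 0 ≤ B) {b : ℝ} (hb : 0 < b) {S : ℝ → ℂ}
    (hS : ∀ t, ‖S t‖ ≤ B) (hM : ∀ t ∈ Set.Icc T (2 * T), ‖S t‖ ≤ M) (hT : 0 < T) :
    ‖∫ t : ℝ, (S t * (‖resonator A t‖ ^ 2 : ℝ)) * (Real.exp (-b * (t - 3 * T / 2) ^ 2) : ℂ)‖
      ≤ M * (∫ t, ‖resonator A t‖ ^ 2 * Real.exp (-b * (t - 3 * T / 2) ^ 2))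
        + B * (A.card : ℝ) ^ 2 * Real.exp (-(b * T ^ 2 / 8)) * (2 * √(Real.pi / b)) := by
  set τ := 3 * T / 2 with hτ
  set N : ℝ := (A.card : ℝ)
  have hintR : Integrable fun t => ‖resonator A t‖ ^ 2 * Real.exp (-b * (t - τ) ^ 2) := by
    have := continuous_resonator hA
    refine (integrable_gaussian_shift hb τ).bdd_mul (c := N ^ 2)
      (by fun_prop) (Filter.Eventually.of_forall fun t => ?_)
    rw [Real.norm_of_nonneg (by positivity)]
    gcongr
    exact norm_resonator_le hA t
  have hg2 := integrable_gaussian_shift (half_pos hb) τ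
  have hint : Integrable fun t => M * (‖resonator A t‖ ^ 2 * Real.exp (-b * (t - τ) ^ 2))
      + B * N ^ 2 * Real.exp (-(b * T ^ 2 / 8)) * Real.exp (-(b / 2) * (t - τ) ^ 2) :=
    (hintR.const_mul M).add (hg2.const_mul _)
  refine (norm_integral_le_of_norm_le hint (Filter.Eventually.of_forall fun t => ?_)).trans ?_
  · rw [norm_mul, norm_mul, Complex.norm_real, Complex.norm_real,
      Real.norm_of_nonneg (by positivity : (0:ℝ) ≤ ‖resonator A t‖ ^ 2),
      Real.norm_of_nonneg (Real.exp_pos _).le]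
    by_cases ht : t ∈ Set.Icc T (2 * T)
    · have h1 : ‖S t‖ * ‖resonator A t‖ ^ 2 * Real.exp (-b * (t - τ) ^ 2)
          ≤ M * ‖resonator A t‖ ^ 2 * Real.exp (-b * (t - τ) ^ 2) := by
        gcongr
        exact hM t ht
      rw [← mul_assoc M]
      exact h1.trans (le_add_of_nonneg_right (by positivity))
    -- Off `[T, 2T]` half of the Gaussian exponent gives the small factor; the other half is kept
    -- for integrability.
    · have h1 : (T / 2) ^ 2 ≤ (t - τ) ^ 2 := by
        rw [sq_le_sq, abs_of_pos (by linarith : 0 < T / 2), le_abs]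
        rw [Set.mem_Icc, not_and_or, not_le, not_le] at ht
        rcases ht with ht | ht
        · right; linarith
        · left; linarith
      have h2 : Real.exp (-b * (t - τ) ^ 2)
          ≤ Real.exp (-(b * T ^ 2 / 8)) * Real.exp (-(b / 2) * (t - τ) ^ 2) := by
        rw [← Real.exp_add]
        apply Real.exp_le_exp.mpr
        have h3 : b / 2 * (T / 2) ^ 2 ≤ b / 2 * (t - τ) ^ 2 := by gcongr
        linarith
      have h5 : ‖S t‖ * ‖resonator A t‖ ^ 2 * Real.exp (-b * (t - τ) ^ 2)
          ≤ B * N ^ 2 * (Real.exp (-(b * T ^ 2 / 8)) * Real.exp (-(b / 2) * (t - τ) ^ 2)) := by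
        gcongr
        · exact hS t
        · exact norm_resonator_le hA t
      rw [mul_assoc (B * N ^ 2)]
      exact h5.trans (le_add_of_nonneg_left (by positivity))
  · rw [integral_add (hintR.const_mul M) (hg2.const_mul _), integral_const_mul,
      integral_const_mul, integral_gaussian_shift]
    have hJ2 : √(Real.pi / (b / 2)) ≤ 2 * √(Real.pi / b) := by
      rw [show Real.pi / (b / 2) = 2 * (Real.pi / b) by field_simp,
        Real.sqrt_mul (by norm_num)]
      have : √(2 : ℝ) ≤ 2 := by rw [Real.sqrt_le_left (by norm_num)]; norm_num
      gcongr
    gcongr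

/-- Resonance with the indicator function of a finite set `A`. -/
theorem resonance_bound {T M : ℝ} (hT : 0 < T) (X D : ℕ) (w : ℕ → ℝ) (hw : ∀ n, 0 ≤ w n)
    (A : Finset ℕ) (hA : ∀ a ∈ A, 0 < a ∧ a ≤ D) (hD : (D : ℝ) ^ 2 ≤ T)
    (hM : ∀ t ∈ Set.Icc T (2 * T),
      ‖∑ n ∈ Finset.Ioc 0 X, (w n : ℂ) * (n : ℂ) ^ (-(t * Complex.I))‖ ≤ M) :
    ∑ n ∈ Finset.Ioc 0 X, w n * (((A ×ˢ A).filter fun p => n * p.1 = p.2).card : ℝ)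
      ≤ M * (A.card + (A.card : ℝ) ^ 2 * Real.exp (-√T / 16))
        + 3 * ((∑ n ∈ Finset.Ioc 0 X, w n) * (A.card : ℝ) ^ 2 * Real.exp (-√T / 16)) := by
  rcases A.eq_empty_or_nonempty with rfl | ⟨a₀, ha₀⟩
  · simp
  have hD0 : (0 : ℝ) < D := by exact_mod_cast (hA a₀ ha₀).1.trans_le (hA a₀ ha₀).2
  have hM0 : 0 ≤ M := (norm_nonneg _).trans (hM T ⟨le_rfl, by linarith⟩)
  have hsT : 0 < √T := Real.sqrt_pos.mpr hT
  have hsq : √T ^ 2 = T := Real.sq_sqrt hT.le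
  -- With `b = T^(-3/2)` the Gaussian has width about `T^(3/4)`: narrow enough to be negligible off
  -- `[T, 2T]`, and wide enough to resolve frequencies `1 / (2D) ≥ 1 / (2√T)`. Both errors are at
  -- most `exp (-√T / 16)`.
  have hb : 0 < 1 / (T * √T) := by positivity
  have hJ0 : 0 < √(Real.pi / (1 / (T * √T))) := Real.sqrt_pos.mpr (by positivity)
  have hB0 : 0 ≤ ∑ n ∈ Finset.Ioc 0 X, w n := Finset.sum_nonneg fun n _ => hw n
  have hδ1 : Real.exp (-(1 / (2 * (D : ℝ))) ^ 2 / (4 * (1 / (T * √T)))) ≤ Real.exp (-√T / 16) := by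
    apply Real.exp_le_exp.mpr
    have e : -(1 / (2 * (D : ℝ))) ^ 2 / (4 * (1 / (T * √T)))
        = -(√T / 16 * (T / (D : ℝ) ^ 2)) := by
      field_simp; norm_num
    have h1 : 1 ≤ T / (D : ℝ) ^ 2 := by rwa [le_div_iff₀ (by positivity), one_mul]
    have h2 : √T / 16 * 1 ≤ √T / 16 * (T / (D : ℝ) ^ 2) := by gcongr
    rw [e]
    linarith
  have hδ2 : Real.exp (-(1 / (T * √T) * T ^ 2 / 8)) ≤ Real.exp (-√T / 16) := by
    apply Real.exp_le_exp.mpr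
    have e : 1 / (T * √T) * T ^ 2 / 8 = √T / 8 := by
      field_simp
      rw [hsq]
    rw [e]
    linarith
  have h1 := integral_resonator_sq_le hA hb (3 * T / 2)
  have h2 := le_norm_integral_mul_resonator_sq hA hb (3 * T / 2) X w hw
  have h3 := norm_integral_mul_resonator_sq_le (fun a ha => (hA a ha).1) hM0 hB0 hb
    (S := fun t : ℝ => ∑ n ∈ Finset.Ioc 0 X, (w n : ℂ) * (n : ℂ) ^ (-(t * Complex.I)))
    (fun t => norm_sum_le_of_le _ fun n hn => by
      rw [norm_mul, norm_natCast_cpow_neg_mul_I (Finset.mem_Ioc.mp hn).1, mul_one,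
        Complex.norm_real, Real.norm_of_nonneg (hw n)]) hM hT
  set J := √(Real.pi / (1 / (T * √T)))
  set B := ∑ n ∈ Finset.Ioc 0 X, w n
  set δ := Real.exp (-√T / 16)
  set N : ℝ := (A.card : ℝ)
  set Q := ∑ n ∈ Finset.Ioc 0 X, w n * (((A ×ˢ A).filter fun p => n * p.1 = p.2).card : ℝ)
  have h4 := h1.trans (show _ ≤ J * (N + N ^ 2 * δ) by gcongr)
  have h5 := (show J * (Q - δ * (B * N ^ 2)) ≤ _ by gcongr).trans h2
  have h6 := h5.trans (h3.trans (show _ ≤ M * (J * (N + N ^ 2 * δ)) + B * N ^ 2 * δ * (2 * J) by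
    gcongr))
  refine le_of_mul_le_mul_left ?_ hJ0
  linarith

/-! ### Divisors of a power of a primorial -/

/-- The exponent of `p` is equidistributed on `0, …, E` among the divisors, and `j` of these `E + 1`
values exceed `E - j`. -/
theorem card_divisors_primorial_pow_mul {Y E p j : ℕ} (hp : p.Prime) (hpY : p ≤ Y) (hj : 0 < j)
    (hjE : j ≤ E) :
    ((primorial Y ^ E).divisors.filter fun a => E < a.factorization p + j).card * (E + 1)
      = (primorial Y ^ E).divisors.card * j := by
  set D' := (∏ q ∈ (Finset.range (Y + 1)).filter Nat.Prime with q ≠ p, q) ^ E with hD'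
  have hsplit : primorial Y ^ E = p ^ E * D' := by
    have hmem : p ∈ (Finset.range (Y + 1)).filter Nat.Prime := by simp [hp]; omega
    rw [hD', ← mul_pow, Finset.filter_ne', Finset.mul_prod_erase _ (fun q => q) hmem]
    rfl
  have hcop : p.Coprime D' := by
    refine Nat.Coprime.pow_right _ (Nat.Coprime.prod_right fun q hq => ?_)
    simp only [Finset.mem_filter] at hq
    exact (Nat.coprime_primes hp hq.1.2).mpr (Ne.symm hq.2)
  have hD0 : D' ≠ 0 := by
    intro h
    have : primorial Y ^ E = 0 := by rw [hsplit, h, mul_zero]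
    exact (pow_pos (primorial_pos Y) E).ne' this
  have hpE : ∀ k, p ^ k ≠ 0 := fun k => (pow_pos hp.pos k).ne'
  have hd : ∀ k, (p ^ k * D').divisors.card = (k + 1) * D'.divisors.card := fun k => by
    rw [Nat.Coprime.card_divisors_mul (hcop.pow_left k), Nat.divisors_prime_pow hp]
    simp
  have hbij : ((primorial Y ^ E).divisors.filter fun a => E < a.factorization p + j).card
      = (p ^ (j - 1) * D').divisors.card := by
    rw [hsplit]
    symm
    -- An exponent above `E - j` means divisibility by `p^(E+1-j)`; the cofactor is an arbitrary
    -- divisor of `p^(j-1) D'`.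
    refine Finset.card_bij (fun a _ => p ^ (E + 1 - j) * a) ?_ ?_ ?_
    · intro a ha
      have ha0 : a ≠ 0 := (Nat.pos_of_mem_divisors ha).ne'
      simp only [Finset.mem_filter, Nat.mem_divisors] at ha ⊢
      refine ⟨⟨?_, mul_ne_zero (hpE _) hD0⟩, ?_⟩
      · have : p ^ E * D' = p ^ (E + 1 - j) * (p ^ (j - 1) * D') := by
          rw [← mul_assoc, ← pow_add]; congr 2; omega
        rw [this]
        exact Nat.mul_dvd_mul_left _ ha.1
      · rw [Nat.factorization_mul (hpE _) ha0, Finsupp.add_apply, hp.factorization_pow]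
        simp
        omega
    · intro a _ a' _ h
      exact Nat.eq_of_mul_eq_mul_left (pow_pos hp.pos _) h
    · intro a ha
      have ha0 : a ≠ 0 := by
        simp only [Finset.mem_filter] at ha
        exact (Nat.pos_of_mem_divisors ha.1).ne'
      simp only [Finset.mem_filter, Nat.mem_divisors] at ha
      have hdvd : p ^ (E + 1 - j) ∣ a := (hp.pow_dvd_iff_le_factorization ha0).mpr (by omega)
      obtain ⟨c, rfl⟩ := hdvd
      refine ⟨c, ?_, rfl⟩
      rw [Nat.mem_divisors]
      refine ⟨?_, mul_ne_zero (hpE _) hD0⟩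
      have : p ^ E * D' = p ^ (E + 1 - j) * (p ^ (j - 1) * D') := by
        rw [← mul_assoc, ← pow_add]; congr 2; omega
      rw [this] at ha
      exact Nat.dvd_of_mul_dvd_mul_left (pow_pos hp.pos _) ha.1.1
  rw [hbij, hsplit, hd, hd, Nat.sub_add_cancel hj]
  ring

theorem factorization_primorial_pow {Y E p : ℕ} (hp : p.Prime) (hpY : p ≤ Y) :
    (primorial Y ^ E).factorization p = E := by
  have h0 : primorial Y ≠ 0 := (primorial_pos Y).ne'
  have h1 : (primorial Y).factorization p = 1 := by
    have hmem : p ∈ (Finset.range (Y + 1)).filter Nat.Prime := by simp [hp]; omega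
    have hsplit : primorial Y = p * ∏ q ∈ ((Finset.range (Y + 1)).filter Nat.Prime).erase p, q :=
      (Finset.mul_prod_erase _ (fun q => q) hmem).symm
    have hne : ∏ q ∈ ((Finset.range (Y + 1)).filter Nat.Prime).erase p, q ≠ 0 := by
      intro h; rw [h, mul_zero] at hsplit; exact h0 hsplit
    have hnd : ¬ p ∣ ∏ q ∈ ((Finset.range (Y + 1)).filter Nat.Prime).erase p, q := by
      rw [← Nat.Prime.coprime_iff_not_dvd hp]
      refine Nat.Coprime.prod_right fun q hq => ?_
      simp only [Finset.mem_erase, Finset.mem_filter] at hq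
      exact (Nat.coprime_primes hp hq.2.2).mpr (Ne.symm hq.1)
    rw [hsplit, Nat.factorization_mul hp.ne_zero hne, Finsupp.add_apply,
      hp.factorization_self, Nat.factorization_eq_zero_of_not_dvd hnd]
  rw [Nat.factorization_pow]
  simp [h1]

/-- Most divisors `a` of a large power of a primorial are such that `n * a` is again one. -/
theorem card_filter_mul_mem_divisors {Y E n : ℕ} (hn : 0 < n) (hnY : n ≤ Y)
    (hnE : ∀ p, n.factorization p ≤ E) :
    ((primorial Y ^ E).divisors.card : ℝ) *
        (1 - (∑ p ∈ n.primeFactors, n.factorization p : ℕ) / ((E : ℝ) + 1))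
      ≤ (((primorial Y ^ E).divisors ×ˢ (primorial Y ^ E).divisors).filter
          fun q => n * q.1 = q.2).card := by
  set A := (primorial Y ^ E).divisors with hA
  have hP0 : primorial Y ^ E ≠ 0 := (pow_pos (primorial_pos Y) E).ne'
  -- A divisor is bad if multiplying by `n` pushes the exponent of some prime above `E`. A union
  -- bound over the primes of `n` gives the total proportion `Ω(n) / (E + 1)`.
  set bad := n.primeFactors.biUnion
    fun p => A.filter fun a => E < a.factorization p + n.factorization p with hbad
  have hsub : (A \ bad).card ≤ ((A ×ˢ A).filter fun q => n * q.1 = q.2).card := by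
    refine Finset.card_le_card_of_injOn (fun a => (a, n * a)) ?_ ?_
    · intro a ha
      simp only [Finset.coe_sdiff, Set.mem_sdiff, Finset.mem_coe] at ha
      obtain ⟨haA, hab⟩ := ha
      simp only [Finset.coe_filter, Set.mem_ofPred_eq, Finset.mem_product, and_true]
      refine ⟨haA, ?_⟩
      have ha0 : a ≠ 0 := (Nat.pos_of_mem_divisors haA).ne'
      rw [hA, Nat.mem_divisors] at haA ⊢
      refine ⟨?_, hP0⟩
      rw [← Nat.factorization_le_iff_dvd (mul_ne_zero hn.ne' ha0) hP0]
      intro p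
      rw [Nat.factorization_mul hn.ne' ha0, Finsupp.add_apply]
      have hle : a.factorization p ≤ (primorial Y ^ E).factorization p :=
        (Nat.factorization_le_iff_dvd ha0 hP0).mpr haA.1 p
      by_cases hp : p ∈ n.primeFactors
      · have hpp := Nat.prime_of_mem_primeFactors hp
        have hpY : p ≤ Y := (Nat.le_of_mem_primeFactors hp).trans hnY
        rw [factorization_primorial_pow hpp hpY]
        by_contra hcon
        apply hab
        rw [hbad, Finset.mem_biUnion]
        refine ⟨p, hp, ?_⟩
        rw [Finset.mem_filter, hA, Nat.mem_divisors]
        exact ⟨haA, by omega⟩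
      · have : n.factorization p = 0 := by
          rwa [← Finsupp.notMem_support_iff, Nat.support_factorization]
        omega
    · intro a _ a' _ h
      exact (Prod.mk.inj h).1
  have hbadc : (bad.card : ℝ)
      ≤ A.card * ((∑ p ∈ n.primeFactors, n.factorization p : ℕ) / ((E : ℝ) + 1)) := by
    have h1 : (bad.card : ℝ) ≤ ∑ p ∈ n.primeFactors,
        ((A.filter fun a => E < a.factorization p + n.factorization p).card : ℝ) := by
      exact_mod_cast Finset.card_biUnion_le
    refine h1.trans ?_
    rw [Nat.cast_sum, Finset.sum_div, Finset.mul_sum]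
    refine Finset.sum_le_sum fun p hp => ?_
    have hpp := Nat.prime_of_mem_primeFactors hp
    have hpY : p ≤ Y := (Nat.le_of_mem_primeFactors hp).trans hnY
    have hpos : 0 < n.factorization p :=
      hpp.factorization_pos_of_dvd hn.ne' (Nat.dvd_of_mem_primeFactors hp)
    have h := card_divisors_primorial_pow_mul hpp hpY hpos (hnE p)
    rw [← mul_div_assoc, le_div_iff₀ (by positivity)]
    exact_mod_cast h.le
  have h2 : (A.card : ℝ) ≤ (A \ bad).card + bad.card := by
    exact_mod_cast (by
      have := Finset.le_card_sdiff bad A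
      omega : A.card ≤ (A \ bad).card + bad.card)
  have h3 : ((A \ bad).card : ℝ) ≤ ((A ×ˢ A).filter fun q => n * q.1 = q.2).card := by
    exact_mod_cast hsub
  rw [mul_sub, mul_one]
  linarith

theorem two_pow_sum_factorization_le {n : ℕ} (hn : n ≠ 0) :
    2 ^ (∑ p ∈ n.primeFactors, n.factorization p) ≤ n := by
  conv_rhs => rw [← Nat.prod_factorization_pow_eq_self hn]
  rw [Finsupp.prod, Nat.support_factorization, ← Finset.prod_pow_eq_pow_sum]
  exact Finset.prod_le_prod' fun p hp =>
    Nat.pow_le_pow_left (Nat.prime_of_mem_primeFactors hp).two_le _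

theorem sum_factorization_mul_log_two_le {n : ℕ} (hn : n ≠ 0) :
    ((∑ p ∈ n.primeFactors, n.factorization p : ℕ) : ℝ) * Real.log 2 ≤ Real.log n := by
  rw [← Real.log_pow]
  apply Real.log_le_log (by positivity)
  exact_mod_cast two_pow_sum_factorization_le hn

/-! ### The main term and the choice of parameters -/

/-- Lower bound for a sum of `(log n) ^ l / n` by telescoping. -/
theorem log_pow_sub_le_sum (l : ℕ) {m Y : ℕ} (hm : 1 ≤ m) (hY : m ≤ Y) :
    (1 - 1 / ((m : ℝ) + 1)) * ((Real.log Y ^ (l + 1) - Real.log m ^ (l + 1)) / (l + 1))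
      ≤ ∑ n ∈ Finset.Ioc m Y, Real.log n ^ l / n := by
  induction Y, hY using Nat.le_induction with
  | base => simp
  | succ Y hY ih =>
    rw [← Finset.insert_Ioc_right_eq_Ioc_add_one (by omega), Finset.sum_insert (by simp)]
    have hm' : (1 : ℝ) ≤ m := by exact_mod_cast hm
    have hmY : (m : ℝ) ≤ Y := by exact_mod_cast hY
    set a := Real.log Y with ha
    set b := Real.log (Y + 1 : ℕ) with hb
    have ha0 : 0 ≤ a := Real.log_nonneg (by linarith)
    have hab : a ≤ b := Real.log_le_log (by linarith) (by push_cast; linarith)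
    have hba : b - a ≤ 1 / Y := by
      have := Real.log_le_sub_one_of_pos (x := ((Y + 1 : ℕ) : ℝ) / Y)
        (by have : (0:ℝ) < Y := by linarith
            positivity)
      rw [Real.log_div (by positivity) (by linarith)] at this
      have e : ((Y + 1 : ℕ) : ℝ) / Y - 1 = 1 / Y := by
        have : (Y : ℝ) ≠ 0 := by linarith
        push_cast; field_simp; ring
      linarith
    -- A mean value bound taken at the right endpoint: `(log x)^l / x` is not monotone, but `(log
    -- x)^l` is, and replacing `1/Y` by `1/(Y+1)` costs only the factor `1 - 1/(m+1)`, uniformly in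
    -- `l`.
    have hgeom : b ^ (l + 1) - a ^ (l + 1) ≤ (l + 1) * b ^ l * (b - a) := by
      have h := (Commute.all b a).mul_geom_sum₂ (l + 1)
      rw [← h, mul_comm]
      refine mul_le_mul_of_nonneg_right ?_ (by linarith)
      calc ∑ i ∈ Finset.range (l + 1), b ^ i * a ^ (l + 1 - 1 - i)
          ≤ ∑ i ∈ Finset.range (l + 1), b ^ l := by
            refine Finset.sum_le_sum fun i hi => ?_
            have hi' : i ≤ l := by simp at hi; omega
            calc b ^ i * a ^ (l + 1 - 1 - i) ≤ b ^ i * b ^ (l + 1 - 1 - i) := by gcongr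
              _ = b ^ l := by rw [← pow_add]; congr 1; omega
        _ = _ := by simp
    have hstep : (1 - 1 / ((m : ℝ) + 1)) * ((b ^ (l + 1) - a ^ (l + 1)) / (l + 1))
        ≤ b ^ l / (Y + 1 : ℕ) := by
      have hY0 : (0 : ℝ) < Y := by linarith
      have h1 : (b ^ (l + 1) - a ^ (l + 1)) / (l + 1) ≤ b ^ l * (1 / Y) := by
        rw [div_le_iff₀ (by positivity)]
        have : (l + 1) * b ^ l * (b - a) ≤ (l + 1) * b ^ l * (1 / Y) := by gcongr
        linarith
      have h2 : 1 - 1 / ((m : ℝ) + 1) ≤ Y / (Y + 1) := by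
        have : 1 / ((Y : ℝ) + 1) ≤ 1 / (m + 1) := by gcongr
        have e : (Y : ℝ) / (Y + 1) = 1 - 1 / (Y + 1) := by field_simp; ring
        linarith
      have h3 : 0 ≤ 1 - 1 / ((m : ℝ) + 1) := by
        have : 1 / ((m : ℝ) + 1) ≤ 1 := by rw [div_le_one (by linarith)]; linarith
        linarith
      have h4 : 0 ≤ (b ^ (l + 1) - a ^ (l + 1)) / (l + 1) :=
        div_nonneg (sub_nonneg.mpr (by gcongr)) (by positivity)
      calc _ ≤ (Y / (Y + 1)) * (b ^ l * (1 / Y)) := by gcongr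
        _ = b ^ l / (Y + 1 : ℕ) := by push_cast; field_simp
    have e : (1 - 1 / ((m : ℝ) + 1)) * ((b ^ (l + 1) - Real.log m ^ (l + 1)) / (l + 1))
      = (1 - 1 / ((m : ℝ) + 1)) * ((b ^ (l + 1) - a ^ (l + 1)) / (l + 1))
        + (1 - 1 / ((m : ℝ) + 1)) * ((a ^ (l + 1) - Real.log m ^ (l + 1)) / (l + 1)) := by ring
    rw [e]
    exact add_le_add hstep ih

/-- The main use of the range of `ℓ`: `ℓ log₂ T ≤ log T`. -/
theorem log_pow_le_of_le_div {T : ℝ} (hT : 0 < T) (h1 : 0 < Real.log T)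
    (h2 : 0 < Real.log (Real.log T)) {l : ℕ}
    (hl : (l : ℝ) ≤ Real.log T / Real.log (Real.log T)) : Real.log T ^ l ≤ T := by
  rw [← Real.log_le_log_iff (by positivity) hT, Real.log_pow]
  rwa [le_div_iff₀ h2] at hl

theorem ceil_sq_bounds {T : ℝ} (hT : 1000 ≤ T) :
    T ^ 2 ≤ (⌈T ^ 2⌉₊ : ℝ) ∧ (⌈T ^ 2⌉₊ : ℝ) ≤ 2 * T ^ 2 ∧
      2 * Real.log T ≤ Real.log ⌈T ^ 2⌉₊ ∧ Real.log ⌈T ^ 2⌉₊ ≤ 3 * Real.log T := by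
  have hX1 : T ^ 2 ≤ (⌈T ^ 2⌉₊ : ℝ) := Nat.le_ceil _
  have hX2 : (⌈T ^ 2⌉₊ : ℝ) ≤ 2 * T ^ 2 := by
    have := (Nat.ceil_lt_add_one (sq_nonneg T)).le
    nlinarith
  have hpos : 0 < T ^ 2 := by positivity
  refine ⟨hX1, hX2, ?_, ?_⟩
  · have := Real.log_le_log hpos hX1
    rw [Real.log_pow] at this
    exact_mod_cast this
  · have h3 : (⌈T ^ 2⌉₊ : ℝ) ≤ T ^ 3 := by nlinarith
    have := Real.log_le_log (hpos.trans_le hX1) h3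
    rw [Real.log_pow] at this
    exact_mod_cast this

/-- Here `(log X)^l ≤ 3^l T`. The length `X ≈ T²` offsets both this factor `T` and the size `|s| ≈
T` in the error term. -/
theorem norm_iteratedDeriv_zeta_sub_sum_le_three_pow {T : ℝ} (hT : 1000 ≤ T)
    (h2 : 1 ≤ Real.log (Real.log T)) {l : ℕ}
    (hl : (l : ℝ) ≤ Real.log T / Real.log (Real.log T)) {t : ℝ} (ht : t ∈ Set.Icc T (2 * T)) :
    ‖iteratedDeriv l riemannZeta (1 + t * Complex.I) - (-1) ^ l * ∑ n ∈ Finset.Ioc 0 ⌈T ^ 2⌉₊,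
        ((Real.log n ^ l / n : ℝ) : ℂ) * (n : ℂ) ^ (-(t * Complex.I))‖ ≤ 10 * 3 ^ l := by
  obtain ⟨hX1, hX2, hX3, hX4⟩ := ceil_sq_bounds hT
  set X := ⌈T ^ 2⌉₊
  have hT0 : 0 < T := by linarith
  have hL1 : 1 ≤ Real.log T := by
    rw [Real.le_log_iff_exp_le hT0]
    linarith [Real.exp_one_lt_d9]
  have hlT : (l : ℝ) ≤ Real.log T := hl.trans (div_le_self (by linarith) h2)
  have hLT : Real.log T ≤ T - 1 := Real.log_le_sub_one_of_pos hT0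
  have hXr : (1 : ℝ) < X := by nlinarith
  have h := norm_iteratedDeriv_zeta_sub_sum_le (t := t) (by linarith [ht.1]) l (X := X)
    (by exact_mod_cast hXr) (by linarith) (by linarith)
  have e : ∑ n ∈ Finset.Ioc 0 X, (Real.log n : ℂ) ^ l * (n : ℂ) ^ (-(1 + t * Complex.I))
      = ∑ n ∈ Finset.Ioc 0 X,
        ((Real.log n ^ l / n : ℝ) : ℂ) * (n : ℂ) ^ (-(t * Complex.I)) := by
    refine Finset.sum_congr rfl fun n hn => ?_
    have hn0 : (n : ℂ) ≠ 0 := by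
      exact_mod_cast (Finset.mem_Ioc.mp hn).1.ne'
    rw [neg_add, Complex.cpow_add _ _ hn0, Complex.cpow_neg_one, Complex.ofReal_div,
      Complex.ofReal_pow, Complex.ofReal_natCast]
    ring
  rw [e] at h
  refine h.trans ?_
  have hlog : Real.log X ^ l ≤ 3 ^ l * T := by
    calc Real.log X ^ l ≤ (3 * Real.log T) ^ l := by gcongr
      _ = 3 ^ l * Real.log T ^ l := mul_pow _ _ _
      _ ≤ 3 ^ l * T := by
        gcongr
        exact log_pow_le_of_le_div hT0 (by linarith) (by linarith) hl
  have hlogX : 0 ≤ Real.log X := by linarith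
  have hn : ‖(1 : ℂ) + t * Complex.I‖ ≤ 1 + 2 * T := by
    refine (norm_add_le _ _).trans ?_
    rw [norm_one, norm_mul, Complex.norm_I, mul_one, Complex.norm_real,
      Real.norm_of_nonneg (by linarith [ht.1])]
    linarith [ht.2]
  have b1 : 2 * Real.log X ^ l / t ≤ 2 * 3 ^ l := by
    calc 2 * Real.log X ^ l / t ≤ 2 * (3 ^ l * T) / T := by
          gcongr
          exact ht.1
      _ = 2 * 3 ^ l := by field_simp
  have b2 : 2 * (l + ‖(1 : ℂ) + t * Complex.I‖) * Real.log X ^ l / X ≤ 8 * 3 ^ l := by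
    calc _ ≤ 2 * (4 * T) * (3 ^ l * T) / T ^ 2 := by
          gcongr
          linarith
      _ = 8 * 3 ^ l := by field_simp; ring
  linarith

theorem sum_log_pow_div_le {T : ℝ} (hT : 1000 ≤ T) (h1 : 3 ≤ Real.log T)
    (h2 : 0 < Real.log (Real.log T)) {l : ℕ}
    (hl : (l : ℝ) ≤ Real.log T / Real.log (Real.log T)) :
    ∑ n ∈ Finset.Ioc 0 ⌈T ^ 2⌉₊, Real.log n ^ l / n ≤ 2 * T ^ 4 := by
  obtain ⟨hX1, hX2, hX3, hX4⟩ := ceil_sq_bounds hT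
  have hT0 : 0 < T := by linarith
  set X := ⌈T ^ 2⌉₊
  have hpow := log_pow_le_of_le_div hT0 (by linarith) h2 hl
  have h3 : (3 : ℝ) ^ l ≤ T := (pow_le_pow_left₀ (by norm_num) h1 l).trans hpow
  have hlog : Real.log X ^ l ≤ T * T := by
    calc Real.log X ^ l ≤ (3 * Real.log T) ^ l := by gcongr
      _ = 3 ^ l * Real.log T ^ l := mul_pow _ _ _
      _ ≤ T * T := by gcongr
  calc ∑ n ∈ Finset.Ioc 0 X, Real.log n ^ l / n ≤ ∑ n ∈ Finset.Ioc 0 X, T * T := by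
        refine Finset.sum_le_sum fun n hn => ?_
        obtain ⟨hn0, hnX⟩ := Finset.mem_Ioc.mp hn
        have hn1 : (1 : ℝ) ≤ n := by exact_mod_cast hn0
        have hnX' : (n : ℝ) ≤ X := by exact_mod_cast hnX
        have hln : 0 ≤ Real.log n := Real.log_nonneg hn1
        refine (div_le_self (by positivity) hn1).trans (le_trans ?_ hlog)
        gcongr
    _ = X * (T * T) := by simp
    _ ≤ 2 * T ^ 2 * (T * T) := by gcongr
    _ = 2 * T ^ 4 := by ring

/-- From `primorial Y ≤ 4^Y` and `log 4 ≤ 1.4`; the constants match because `2 · 750 · 1.4 = 2100`.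
-/
theorem primorial_pow_sq_le {T : ℝ} (hT : 0 < T) (h1 : 0 < Real.log T)
    (h2 : 0 < Real.log (Real.log T)) {Y E : ℕ}
    (hY : (Y : ℝ) ≤ Real.log T / (2100 * Real.log (Real.log T)))
    (hE : (E : ℝ) ≤ 750 * Real.log (Real.log T)) : ((primorial Y ^ E : ℕ) : ℝ) ^ 2 ≤ T := by
  have hle : ((primorial Y ^ E : ℕ) : ℝ) ≤ (4 : ℝ) ^ (Y * E) := by
    rw [pow_mul]
    exact_mod_cast Nat.pow_le_pow_left (primorial_le_four_pow Y) E
  refine (pow_le_pow_left₀ (by positivity) hle 2).trans ?_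
  rw [← Real.log_le_log_iff (by positivity) hT, Real.log_pow, Real.log_pow]
  have h4 : Real.log 4 ≤ 1.4 := by
    rw [show (4 : ℝ) = 2 ^ 2 by norm_num, Real.log_pow]
    have := Real.log_two_lt_d9
    push_cast; linarith
  push_cast
  calc 2 * ((Y : ℝ) * E * Real.log 4)
      ≤ 2 * (Real.log T / (2100 * Real.log (Real.log T)) * (750 * Real.log (Real.log T)) * 1.4) := by
        gcongr
    _ = Real.log T := by field_simp; norm_num

/-! ### Numerical comparison and conclusion -/

theorem exp_eulerMascheroni_mul_le {l : ℕ} (hl : 1 ≤ l) :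
    Real.exp Real.eulerMascheroniConstant * (l : ℝ) ^ l * (((l : ℝ) + 1) ^ (l + 1))⁻¹
      ≤ 0.975 / (l + 1) := by
  have hexp : Real.exp Real.eulerMascheroniConstant ≤ 1.95 := by
    -- Cubing reduces the claim to `e² ≤ 1.95³`.
    have h1 : Real.exp Real.eulerMascheroniConstant ≤ Real.exp (2 / 3) :=
      Real.exp_le_exp.mpr Real.eulerMascheroniConstant_lt_two_thirds.le
    refine h1.trans (le_of_pow_le_pow_left₀ (n := 3) (by norm_num) (by norm_num) ?_)
    have h2 : Real.exp (2 / 3) ^ 3 = Real.exp 1 ^ 2 := by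
      rw [← Real.exp_nat_mul, ← Real.exp_nat_mul]; norm_num
    have h3 := Real.exp_one_lt_d9
    have h4 := Real.exp_pos 1
    rw [h2]
    nlinarith
  have hl0 : (0 : ℝ) < l := by exact_mod_cast hl
  have hbern : 2 * (l : ℝ) ^ l ≤ ((l : ℝ) + 1) ^ l := by
    have h := one_add_mul_le_pow (a := 1 / (l : ℝ)) (by
      have : 0 ≤ 1 / (l : ℝ) := by positivity
      linarith) l
    have e : 1 + (l : ℝ) * (1 / l) = 2 := by field_simp; norm_num
    rw [e] at h
    calc 2 * (l : ℝ) ^ l ≤ (1 + 1 / (l : ℝ)) ^ l * (l : ℝ) ^ l := by gcongr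
      _ = ((l : ℝ) + 1) ^ l := by rw [← mul_pow]; congr 1; field_simp
  rw [← div_eq_mul_inv, div_le_div_iff₀ (by positivity) (by positivity), pow_succ]
  calc Real.exp Real.eulerMascheroniConstant * (l : ℝ) ^ l * (l + 1)
      ≤ 1.95 * (l : ℝ) ^ l * (l + 1) := by gcongr
    _ = 0.975 * (2 * (l : ℝ) ^ l * (l + 1)) := by ring
    _ ≤ 0.975 * (((l : ℝ) + 1) ^ l * (l + 1)) := by gcongr

/-- For `L ≥ 10^6` the terms `7^(l+1)` and `3^l` are tiny against `L^(l+1) / (l+1)`, and `0.998² /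
1.001` exceeds `0.975` with room to spare. -/
theorem le_of_resonance_inequality {L M : ℝ} {l : ℕ} (hl : 1 ≤ l) (hL : 10 ^ 6 ≤ L)
    (h : 0.998 * (0.998 * ((L ^ (l + 1) - 7 ^ (l + 1)) / (l + 1)))
      ≤ (M + 10 * 3 ^ l) * 1.001 + 1) :
    Real.exp Real.eulerMascheroniConstant * (l : ℝ) ^ l * (((l : ℝ) + 1) ^ (l + 1))⁻¹ * L ^ (l + 1)
      ≤ M := by
  have hL0 : 0 < L := by linarith
  set Q : ℝ := L ^ (l + 1) / (l + 1) with hQ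
  have hV : (7 : ℝ) ^ (l + 1) ≤ 0.0001 * Q := by
    rw [hQ, mul_div_assoc', le_div_iff₀ (by positivity)]
    have h2 : (l : ℝ) + 1 ≤ 2 ^ (l + 1) := by
      exact_mod_cast (Nat.lt_two_pow_self (n := l + 1)).le
    calc (7 : ℝ) ^ (l + 1) * (l + 1) ≤ 7 ^ (l + 1) * 2 ^ (l + 1) := by gcongr
      _ = 14 ^ l * 14 := by rw [← mul_pow, pow_succ]; norm_num
      _ ≤ L ^ l * (0.0001 * L) := by gcongr <;> linarith
      _ = 0.0001 * L ^ (l + 1) := by rw [pow_succ]; ring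
  have h3 : (3 : ℝ) ^ l ≤ 7 ^ (l + 1) := by
    calc (3 : ℝ) ^ l ≤ 7 ^ l := by gcongr; norm_num
      _ ≤ 7 ^ (l + 1) := pow_le_pow_right₀ (by norm_num) (by omega)
  have h4 : (7 : ℝ) ^ (l + 1) / (l + 1) ≤ 7 ^ (l + 1) :=
    div_le_self (by positivity) (by have : (0:ℝ) ≤ l := by positivity
                                    linarith)
  have h5 : (1 : ℝ) ≤ 3 ^ l := one_le_pow₀ (by norm_num)
  rw [sub_div, ← hQ] at h
  have h6 : Real.exp Real.eulerMascheroniConstant * (l : ℝ) ^ l * (((l : ℝ) + 1) ^ (l + 1))⁻¹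
      * L ^ (l + 1) ≤ 0.975 / (l + 1) * L ^ (l + 1) := by
    gcongr
    exact exp_eulerMascheroni_mul_le hl
  have h7 : 0.975 / ((l : ℝ) + 1) * L ^ (l + 1) = 0.975 * Q := by rw [hQ]; ring
  rw [h7] at h6
  linarith

/-- Divides by the number `N` of resonator terms. Since `N ≤ T` and `B ≤ 2T^4`, the smallness of
`T^5 δ` controls both error terms. -/
theorem arith_of_resonance {T N B K V δ : ℝ} (hT : 1000 ≤ T) (hδ : 6 * T ^ 5 * δ ≤ 1)
    (hδ0 : 0 < δ) (hN1 : 1 ≤ N) (hNT : N ≤ T) (hK : 0 ≤ K) (hB : B ≤ 2 * T ^ 4)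
    (h : N * V ≤ K * (N + N ^ 2 * δ) + 3 * (B * N ^ 2 * δ)) : V ≤ K * 1.001 + 1 := by
  have hNδ0 : 0 ≤ N * δ := mul_nonneg (by linarith) hδ0.le
  have hT5 : N * δ * (6 * T ^ 4) ≤ 1 := by
    have h5 : N * δ * (6 * T ^ 4) ≤ T * δ * (6 * T ^ 4) := by gcongr
    linarith
  have hNδ : N * δ ≤ 0.001 := by
    have h3 : (1000 : ℝ) ≤ 6 * T ^ 4 := by
      have : T ≤ T ^ 4 := le_self_pow₀ (by linarith) (by norm_num)
      linarith
    have h4 := mul_le_mul_of_nonneg_left h3 hNδ0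
    linarith
  have hBN : 3 * (B * (N * δ)) ≤ 1 := by
    have := mul_le_mul_of_nonneg_right hB hNδ0
    linarith
  refine le_of_mul_le_mul_left (h.trans ?_) (by linarith : 0 < N)
  have e : K * (N + N ^ 2 * δ) + 3 * (B * N ^ 2 * δ)
      = N * (K * (1 + N * δ) + 3 * (B * (N * δ))) := by ring
  rw [e]
  gcongr
  linarith

theorem lower_bound_of_forall_norm_le {T : ℝ} (hT : 1000 ≤ T) (h1 : 3 ≤ Real.log T)
    (h2 : 1 ≤ Real.log (Real.log T))
    (hL : 10 ^ 6 ≤ Real.log (Real.log T) - Real.log (Real.log (Real.log T)) - Real.log 4200)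
    (hδ : 6 * T ^ 5 * Real.exp (-√T / 16) ≤ 1) {l : ℕ} (hl1 : 1 ≤ l)
    (hl : (l : ℝ) ≤ Real.log T / Real.log (Real.log T)) {M : ℝ}
    (hM : ∀ t ∈ Set.Icc T (2 * T), ‖iteratedDeriv l riemannZeta (1 + t * Complex.I)‖ ≤ M) :
    Real.exp Real.eulerMascheroniConstant * (l : ℝ) ^ l * (((l : ℝ) + 1) ^ (l + 1))⁻¹ *
      (Real.log (Real.log T) - Real.log (Real.log (Real.log T)) - Real.log 4200) ^ (l + 1) ≤ M := by
  have hT0 : 0 < T := by linarith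
  set L2 := Real.log (Real.log T) with hL2
  set y := Real.log T / (2100 * L2) with hy
  have hy0 : 0 < y := by positivity
  set L := L2 - Real.log L2 - Real.log 4200 with hLdef
  have hLy : L = Real.log (y / 2) := by
    have : y / 2 = Real.log T / L2 / 4200 := by rw [hy]; field_simp; norm_num
    rw [this, Real.log_div (by positivity) (by norm_num),
      Real.log_div (by positivity) (by positivity)]
  -- Since `L = log (y / 2)`, a large `L` forces a large `y`.
  have hybig : 10 ^ 6 ≤ y / 2 := by
    have h := Real.log_le_sub_one_of_pos (half_pos hy0)
    linarith
  set Y := ⌊y⌋₊ with hYdef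
  have hYle : (Y : ℝ) ≤ y := Nat.floor_le hy0.le
  have hYge : y / 2 ≤ Y := by
    have := Nat.lt_floor_add_one y
    linarith
  have hY500 : 500 ≤ Y := by
    have : (500 : ℝ) ≤ Y := by linarith
    exact_mod_cast this
  have hlogY : L ≤ Real.log Y := by
    rw [hLy]; exact Real.log_le_log (by linarith) hYge
  have hlogYle : Real.log Y ≤ L2 := by
    refine Real.log_le_log (by linarith) (hYle.trans ?_)
    exact div_le_self (by linarith) (by linarith)
  set E := ⌊750 * L2⌋₊ with hE
  have hEle : (E : ℝ) ≤ 750 * L2 := Nat.floor_le (by linarith)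
  have hEge : 750 * L2 ≤ E + 1 := (Nat.lt_floor_add_one _).le
  have hD2 := primorial_pow_sq_le hT0 (by linarith) (by linarith) hYle hEle
  set D := primorial Y ^ E with hD
  have hDpos : 0 < D := pow_pos (primorial_pos Y) E
  set A := D.divisors with hA
  have hAD : ∀ a ∈ A, 0 < a ∧ a ≤ D := fun a ha =>
    ⟨Nat.pos_of_mem_divisors ha, Nat.divisor_le ha⟩
  have hN1 : (1 : ℝ) ≤ A.card := by
    have : 0 < A.card := Finset.card_pos.mpr ⟨1, Nat.one_mem_divisors.mpr hDpos.ne'⟩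
    exact_mod_cast this
  have hNT : (A.card : ℝ) ≤ T := by
    have h3 : (A.card : ℝ) ≤ D := by exact_mod_cast Nat.card_divisors_le_self D
    have h4 : (1 : ℝ) ≤ D := by exact_mod_cast hDpos
    nlinarith
  obtain ⟨hX1, hX2, -, -⟩ := ceil_sq_bounds hT
  set X := ⌈T ^ 2⌉₊ with hX
  have hw : ∀ n : ℕ, 0 ≤ Real.log n ^ l / n := fun n =>
    div_nonneg (pow_nonneg (Real.log_natCast_nonneg n) l) (Nat.cast_nonneg n)
  have hres := resonance_bound hT0 X D (fun n => Real.log n ^ l / n) hw A hAD hD2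
    (M := M + 10 * 3 ^ l) (fun t ht => by
      have g1 := norm_iteratedDeriv_zeta_sub_sum_le_three_pow hT h2 hl ht
      have g2 := norm_sub_norm_le ((-1) ^ l * ∑ n ∈ Finset.Ioc 0 X,
        ((Real.log n ^ l / n : ℝ) : ℂ) * (n : ℂ) ^ (-(t * Complex.I)))
        (iteratedDeriv l riemannZeta (1 + t * Complex.I))
      rw [norm_sub_rev, norm_mul, norm_pow, norm_neg, norm_one, one_pow, one_mul] at g2
      have g3 := hM t ht
      linarith)
  have hM0 : 0 ≤ M := (norm_nonneg _).trans (hM T ⟨le_rfl, by linarith⟩)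
  have hB := sum_log_pow_div_le hT h1 (by linarith) hl
  have hcard : ∀ n ∈ Finset.Ioc 500 Y, (A.card : ℝ) * 0.998
      ≤ (((A ×ˢ A).filter fun p => n * p.1 = p.2).card : ℝ) := by
    intro n hn
    obtain ⟨hn500, hnY⟩ := Finset.mem_Ioc.mp hn
    have hn0 : n ≠ 0 := by omega
    have hΩ := sum_factorization_mul_log_two_le hn0
    set Ω := ∑ p ∈ n.primeFactors, n.factorization p with hΩdef
    have hlogn : Real.log n ≤ L2 :=
      (Real.log_le_log (by positivity) (by exact_mod_cast hnY)).trans hlogYle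
    -- `1.5` exceeds `1 / log 2`. Against `E + 1 ≥ 750 L2` the bad proportion is at most `1.5 / 750
    -- = 0.002`.
    have hΩ2 : (Ω : ℝ) ≤ 1.5 * L2 := by
      have := Real.log_two_gt_d9
      have h0 : (0 : ℝ) ≤ Ω := Nat.cast_nonneg _
      nlinarith
    have hΩE : Ω ≤ E := by
      have : (Ω : ℝ) ≤ E := by linarith
      exact_mod_cast this
    have h := card_filter_mul_mem_divisors (Y := Y) (E := E) (n := n) (by omega) hnY (fun p => by
      by_cases hp : p ∈ n.primeFactors
      · exact (Finset.single_le_sum (f := fun p => n.factorization p)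
          (fun _ _ => Nat.zero_le _) hp).trans hΩE
      · rw [← Nat.support_factorization, Finsupp.notMem_support_iff] at hp
        omega)
    refine le_trans ?_ h
    gcongr
    have : (Ω : ℝ) / ((E : ℝ) + 1) ≤ 0.002 := by
      rw [div_le_iff₀ (by positivity)]; linarith
    linarith
  have hYX : Y ≤ X := by
    have : (Y : ℝ) ≤ X := by
      have h3 : y ≤ Real.log T := div_le_self (by linarith) (by linarith)
      have h4 := Real.log_le_sub_one_of_pos hT0
      nlinarith
    exact_mod_cast this
  have hlow : A.card * (0.998 * (0.998 * ((L ^ (l + 1) - 7 ^ (l + 1)) / (l + 1))))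
      ≤ ∑ n ∈ Finset.Ioc 0 X, Real.log n ^ l / n *
        (((A ×ˢ A).filter fun p => n * p.1 = p.2).card : ℝ) := by
    -- Starting the sum after 500 makes the telescoping loss `1/501 < 0.002`, and costs only the
    -- term `7^(l+1)`.
    have hlog500 : Real.log (500 : ℕ) ≤ 7 := by
      have h3 : Real.log (500 : ℕ) ≤ Real.log (2 ^ 9) :=
        Real.log_le_log (by norm_num) (by norm_num)
      rw [Real.log_pow] at h3
      have := Real.log_two_lt_d9
      push_cast at h3 ⊢
      linarith
    have hS := log_pow_sub_le_sum l (m := 500) (Y := Y) (by norm_num) hY500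
    have h0 : 0 ≤ Real.log (500 : ℕ) := Real.log_natCast_nonneg 500
    have hLL : L ^ (l + 1) - 7 ^ (l + 1)
        ≤ Real.log Y ^ (l + 1) - Real.log (500 : ℕ) ^ (l + 1) :=
      sub_le_sub (pow_le_pow_left₀ (by linarith) hlogY _) (pow_le_pow_left₀ h0 hlog500 _)
    have hpos : 0 ≤ L ^ (l + 1) - 7 ^ (l + 1) := by
      rw [sub_nonneg]; gcongr; linarith
    have hS2 : 0.998 * ((L ^ (l + 1) - 7 ^ (l + 1)) / (l + 1))
        ≤ ∑ n ∈ Finset.Ioc 500 Y, Real.log n ^ l / n := by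
      refine le_trans ?_ hS
      have hnum : (0.998 : ℝ) ≤ 1 - 1 / ((500 : ℕ) + 1) := by norm_num
      exact mul_le_mul hnum (div_le_div_of_nonneg_right hLL (by positivity))
        (div_nonneg hpos (by positivity)) (by norm_num)
    calc _ ≤ A.card * (0.998 * ∑ n ∈ Finset.Ioc 500 Y, Real.log n ^ l / n) := by gcongr
      _ = ∑ n ∈ Finset.Ioc 500 Y, Real.log n ^ l / n * (A.card * 0.998) := by
        rw [← Finset.sum_mul]; ring
      _ ≤ ∑ n ∈ Finset.Ioc 500 Y, Real.log n ^ l / n *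
          (((A ×ˢ A).filter fun p => n * p.1 = p.2).card : ℝ) :=
        Finset.sum_le_sum fun n hn => mul_le_mul_of_nonneg_left (hcard n hn) (hw n)
      _ ≤ _ := Finset.sum_le_sum_of_subset_of_nonneg
        (Finset.Ioc_subset_Ioc (Nat.zero_le _) hYX)
        fun n _ _ => mul_nonneg (hw n) (Nat.cast_nonneg _)
  refine le_of_resonance_inequality hl1 hL ?_
  have hall := hlow.trans hres
  exact arith_of_resonance hT hδ (Real.exp_pos _) hN1 hNT (by positivity) hB hall

theorem eventually_resonance_conditions : ∀ᶠ T : ℝ in atTop,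
    1000 ≤ T ∧ 3 ≤ Real.log T ∧ 1 ≤ Real.log (Real.log T) ∧
    10 ^ 6 ≤ Real.log (Real.log T) - Real.log (Real.log (Real.log T)) - Real.log 4200 ∧
    6 * T ^ 5 * Real.exp (-√T / 16) ≤ 1 := by
  have hlog := Real.tendsto_log_atTop
  have h3 : Tendsto (fun x : ℝ => x - Real.log x - Real.log 4200) atTop atTop := by
    have h := Real.isLittleO_log_id_atTop.bound (show (0 : ℝ) < 1 / 2 by norm_num)
    refine tendsto_atTop_mono' _ (f₁ := fun x : ℝ => x / 2 - Real.log 4200) ?_ ?_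
    · filter_upwards [h, eventually_ge_atTop 0] with x hx hx0
      simp only [id, Real.norm_of_nonneg hx0] at hx
      have := (Real.le_norm_self _).trans hx
      linarith
    · exact tendsto_atTop_add_const_right _ _ (tendsto_id.atTop_div_const (by norm_num))
  have hexp : Tendsto (fun T : ℝ => 6 * T ^ 5 * Real.exp (-√T / 16)) atTop (𝓝 0) := by
    have hs : Tendsto (fun T : ℝ => √T / 16) atTop atTop :=
      Real.tendsto_sqrt_atTop.atTop_div_const (by norm_num)
    -- With `u = √T / 16` the expression is `6 · 16^10 · u^10 e^(-u)`.
    have h := ((Real.tendsto_pow_mul_exp_neg_atTop_nhds_zero 10).comp hs).const_mul (6 * 16 ^ 10)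
    rw [mul_zero] at h
    refine h.congr' ?_
    filter_upwards [eventually_ge_atTop 0] with T hT
    have e : (√T) ^ 10 = T ^ 5 := by
      rw [show 10 = 2 * 5 by norm_num, pow_mul, Real.sq_sqrt hT]
    rw [Function.comp_apply, div_pow, e, neg_div]
    ring
  filter_upwards [eventually_ge_atTop 1000, hlog.eventually_ge_atTop 3,
    (hlog.comp hlog).eventually_ge_atTop 1,
    (h3.comp (hlog.comp hlog)).eventually_ge_atTop (10 ^ 6),
    hexp.eventually_le_const one_pos] with T a b c d e
  exact ⟨a, b, c, d, e⟩

theorem theorem1 :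
    ∃ C T₀ : ℝ, ∀ T : ℝ, T₀ ≤ T → ∀ ℓ : ℕ, 1 ≤ ℓ →
      (ℓ : ℝ) ≤ Real.log T / Real.log (Real.log T) →
      ∃ M : ℝ,
        IsGreatest
          ((fun t : ℝ => ‖iteratedDeriv ℓ riemannZeta (1 + (t : ℂ) * Complex.I)‖) ''
            Set.Icc T (2 * T)) M ∧
        Real.exp Real.eulerMascheroniConstant * (ℓ : ℝ) ^ ℓ * (((ℓ : ℝ) + 1) ^ (ℓ + 1))⁻¹ *
          (Real.log (Real.log T) - Real.log (Real.log (Real.log T)) - C) ^ (ℓ + 1) ≤ M := by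
  obtain ⟨T₀, hT₀⟩ := eventually_atTop.mp eventually_resonance_conditions
  -- `4200 = 2 · 2100`: the 2100 comes from `D² ≤ T`, the 2 from rounding `Y` down to an integer.
  refine ⟨Real.log 4200, T₀, fun T hT l hl1 hl => ?_⟩
  obtain ⟨h0, h1, h2, h3, h4⟩ := hT₀ T hT
  have hcont : ContinuousOn
      (fun t : ℝ => ‖iteratedDeriv l riemannZeta (1 + (t : ℂ) * Complex.I)‖)
      (Set.Icc T (2 * T)) := by
    intro t ht
    have hne : (1 : ℂ) + t * Complex.I ≠ 1 := by
      intro h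
      have := congrArg Complex.im h
      simp at this
      linarith [ht.1]
    have hc : ContinuousAt (fun t : ℝ => (1 : ℂ) + t * Complex.I) t := by fun_prop
    exact (ContinuousAt.comp (f := fun t : ℝ => (1 : ℂ) + t * Complex.I)
      (analyticAt_iteratedDeriv_riemannZeta l hne).continuousAt hc).norm.continuousWithinAt
  obtain ⟨M, hM⟩ := (isCompact_Icc.image_of_continuousOn hcont).exists_isGreatest
    ((Set.nonempty_Icc.mpr (by linarith)).image _)
  exact ⟨M, hM, lower_bound_of_forall_norm_le h0 h1 h2 h3 h4 hl1 hl
    fun t ht => hM.2 ⟨t, ht, rfl⟩⟩
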